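/- Let $\mathbb F$ be a field, $d\ge 0$ an integer, and let $p=(\{\theta_i\}_{i=0}^d;\{\theta^*_i\}_{i=0}^d)$ be a feasible sequence of scalars in $\mathbb F$, meaning that $\theta_i\ne\theta_j$ and $\theta^*_i\neq\theta^*_j$ for $i\ne j$, and that the expressions $$\frac{\theta_{i-2}-\theta_{i+1}}{\theta_{i-1}-\theta_i},\qquad \frac{\theta^*_{i-2}-\theta^*_{i+1}}{\theta^*_{i-1}-\theta^*_i}$$ are equal and independent of $i$ for $2\le i\le d-1$. Let $\check T$ be the (associative, unital) $\mathbb F$-algebra with generators $\epsilon_i$ (nonstarred) and $\epsilon_i^*$ (starred), $0\le i\le d$, and relations $\epsilon_i\epsilon_j=\delta_{ij}\epsilon_i$, $\epsilon^*_i\epsilon^*_j=\delta_{ij}\epsilon^*_i$. In $\check T$ put $a=\sum_i\theta_i\epsilon_i$, $a^*=\sum_i\theta_i^*\epsilon_i^*$, with the conventions $a^0=\sum_i\epsilon_i$, $a^{*0}=\sum_i\epsilon^*_i$. A word of length $n$ is a product $g_1\cdots g_n$ of generators in which starred and nonstarred generators alternate; the word of length $0$ is $1$ and is called trivial. Two nontrivial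 words have the same type if they have the same length, the same first generator and the same last generator; the trivial word forms a type by itself. For $n\geq 0$, $[n]$ denotes the type of the words of length $2n+1$ that begin and end with $\epsilon_0^*$. Write $\overline g$ for the index of a generator $g$. Say that $m$ is between $i,j$ if $i\ge m>j$ or $i\le m<j$. A word $g_1\cdots g_n$ is zigzag if $\overline g_i$ is not between $\overline g_{i-1},\overline g_{i+1}$ for $2\le i\le n-1$, and at least one of $\overline g_{i-1},\overline g_i$ is not between $\overline g_{i-2},\overline g_{i+1}$ for $3\le i\le n-1$. For a type $\lambda$ let $\check T_\lambda$ be the span of the words of type $\lambda$ and $Z_\lambda$ the span of the zigzag words of type $\lambda$. A relator is an element $u\,a^{*k}v$ (resp. $u\,a^{k}v$) of $\check T$, where $u,v$ are nontrivial words such that the last generator of $u$ and the first generator of $v$ are both nonstarred (resp. both starred), with indices $i,j$ respectively, and $0\le k<|i-j|$. Let $R_\lambda$ be the span of the relators contained in $\check T_\lambda$. The type $\lambda$ is called $(p,\mathbb F)$-direct if the sum $R_\lambda+Z_\lambda$ is direct. Let $\tilde T$ be the $\mathbb F$-algebra with generators $\varepsilon_i,\varepsilon_i^*$ ($0\le i\le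 d$) and relations $\varepsilon_i\varepsilon_j=\delta_{ij}\varepsilon_i$, $\varepsilon^*_i\varepsilon^*_j=\delta_{ij}\varepsilon^*_i$, and $$0=\sum_{\ell=0}^d\theta_\ell^k\,\varepsilon^*_i\varepsilon_\ell\varepsilon^*_j,\qquad 0=\sum_{\ell=0}^d\theta_\ell^{*k}\,\varepsilon_i\varepsilon^*_\ell\varepsilon_j\qquad(0\le i,j\le d,\ 0\le k<|i-j|).$$ Then $\varepsilon_0^*\tilde T\varepsilon_0^*$ is an $\mathbb F$-algebra with identity $\varepsilon^*_0$. There is a (necessarily unique) $\mathbb F$-algebra homomorphism $\tilde\nu:\mathbb F[x_0,\dots,x_d]\to\varepsilon_0^*\tilde T\varepsilon_0^*$ with $\tilde\nu(x_i)=\varepsilon_0^*\varepsilon_i\varepsilon_0^*$ for $0\le i\le d$, and the following are equivalent: (i) $\tilde\nu$ is an isomorphism; (ii) for every integer $n\ge0$ the type $[n]$ is $(p,\mathbb F)$-direct. -/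

import Mathlib

noncomputable section

namespace SharpTD

/-- A sequence `p = ({θ_i}_{i=0}^d; {θ*_i}_{i=0}^d)` of scalars taken from `F`. -/
structure Params (d : ℕ) (F : Type*) where
  th : Fin (d + 1) → F
  ths : Fin (d + 1) → F

/-- Feasibility: the `θ_i` are mutually distinct, the `θ*_i` are mutually distinct, and the
expressions `(θ_{i-2} - θ_{i+1}) / (θ_{i-1} - θ_i)` and `(θ*_{i-2} - θ*_{i+1}) / (θ*_{i-1} - θ*_i)`
are equal and independent of `i` for `2 ≤ i ≤ d - 1` (below, `m = i - 2`). -/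
structure Params.Feasible {d : ℕ} {F : Type*} [Field F] (p : Params d F) : Prop where
  th_inj : Function.Injective p.th
  ths_inj : Function.Injective p.ths
  recurrence : ∃ b : F, ∀ (m : ℕ) (h : m + 3 < d + 1),
    (p.th ⟨m, by omega⟩ - p.th ⟨m + 3, h⟩) /
        (p.th ⟨m + 1, by omega⟩ - p.th ⟨m + 2, by omega⟩) = b ∧
    (p.ths ⟨m, by omega⟩ - p.ths ⟨m + 3, h⟩) /
        (p.ths ⟨m + 1, by omega⟩ - p.ths ⟨m + 2, by omega⟩) = b

/-- The symbols for the idempotent generators: `plain i` is the nonstarred generator of index `i`,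
and `star i` is the starred generator of index `i`. -/
inductive Gen (d : ℕ) : Type where
  | plain (i : Fin (d + 1)) : Gen d
  | star (i : Fin (d + 1)) : Gen d

/-- The index of a generator. -/
def Gen.index {d : ℕ} : Gen d → ℕ
  | .plain i => i
  | .star i => i

/-- Whether a generator is starred. -/
def Gen.starred {d : ℕ} : Gen d → Bool
  | .plain _ => false
  | .star _ => true

/-- Two generators are alternating when one is starred and the other is nonstarred. -/
def Gen.Alternating {d : ℕ} (g h : Gen d) : Prop := g.starred ≠ h.starred

/-! ### The algebra `Ť` -/

/-- The defining relations of `Ť`: each of the two families consists of mutually orthogonal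
idempotents. -/
inductive TCheckRel (d : ℕ) (F : Type*) [Field F] :
    FreeAlgebra F (Gen d) → FreeAlgebra F (Gen d) → Prop where
  | plain (i j : Fin (d + 1)) : TCheckRel d F
      (FreeAlgebra.ι F (Gen.plain i) * FreeAlgebra.ι F (Gen.plain j))
      (if i = j then FreeAlgebra.ι F (Gen.plain i) else 0)
  | star (i j : Fin (d + 1)) : TCheckRel d F
      (FreeAlgebra.ι F (Gen.star i) * FreeAlgebra.ι F (Gen.star j))
      (if i = j then FreeAlgebra.ι F (Gen.star i) else 0)

/-- The algebra `Ť = Ť(d, F)`. -/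
abbrev TCheck (d : ℕ) (F : Type*) [Field F] : Type _ := RingQuot (TCheckRel d F)

/-- The idempotent generators of `Ť`. -/
def TCheck.gen {d : ℕ} (F : Type*) [Field F] (g : Gen d) : TCheck d F :=
  RingQuot.mkAlgHom F (TCheckRel d F) (FreeAlgebra.ι F g)

/-- The powers `a^k` of `a = ∑ θ_i ε_i` in `Ť`, with the convention `a^0 = ∑ ε_i`
(which is not the identity of `Ť`). -/
def TCheck.aPow {d : ℕ} {F : Type*} [Field F] (p : Params d F) (k : ℕ) : TCheck d F :=
  if k = 0 then ∑ l, TCheck.gen F (Gen.plain l)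
  else (∑ l, p.th l • TCheck.gen F (Gen.plain l)) ^ k

/-- The powers `a*^k` of `a* = ∑ θ*_i ε*_i` in `Ť`, with the convention `a*^0 = ∑ ε*_i`. -/
def TCheck.aStarPow {d : ℕ} {F : Type*} [Field F] (p : Params d F) (k : ℕ) : TCheck d F :=
  if k = 0 then ∑ l, TCheck.gen F (Gen.star l)
  else (∑ l, p.ths l • TCheck.gen F (Gen.star l)) ^ k

/-! ### Words and types -/

/-- Words: finite sequences of idempotent generators in which consecutive ones are alternating.
The empty sequence is the trivial word. -/
def Word (d : ℕ) : Type := {l : List (Gen d) // l.IsChain Gen.Alternating}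

/-- The element `g_1 g_2 ⋯ g_n` of `Ť` given by a word (the identity for the trivial word). -/
def Word.toTCheck {d : ℕ} (F : Type*) [Field F] (w : Word d) : TCheck d F :=
  (w.1.map (TCheck.gen F)).prod

/-- Two words are equivalent when they have the same length, the same beginning and the same end
(so that the trivial word is equivalent to itself only). -/
instance Word.setoid (d : ℕ) : Setoid (Word d) where
  r u v := u.1.length = v.1.length ∧ u.1.head? = v.1.head? ∧ u.1.getLast? = v.1.getLast?
  iseqv := ⟨fun _ => ⟨rfl, rfl, rfl⟩, fun h => ⟨h.1.symm, h.2.1.symm, h.2.2.symm⟩,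
    fun h k => ⟨h.1.trans k.1, h.2.1.trans k.2.1, h.2.2.trans k.2.2⟩⟩

/-- The set `Λ` of types, that is, of equivalence classes of words. -/
def WordType (d : ℕ) : Type := Quotient (Word.setoid d)

/-- The type of a word. -/
def Word.type {d : ℕ} (w : Word d) : WordType d := Quotient.mk _ w

/-- `Ť_λ`: the span of the words of type `λ`. -/
def TCheck.component {d : ℕ} (F : Type*) [Field F] (lam : WordType d) :
    Submodule F (TCheck d F) :=
  Submodule.span F {x | ∃ w : Word d, w.type = lam ∧ w.toTCheck F = x}

/-- `m` is between `i, j` when `i ≥ m > j` or `i ≤ m < j`. -/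
def Between (i j m : ℕ) : Prop := (i ≥ m ∧ m > j) ∨ (i ≤ m ∧ m < j)

/-- A word `g_1 g_2 ⋯ g_n` with indices `c_1, …, c_n` is zigzag when `c_i` is not between
`c_{i-1}, c_{i+1}` for `2 ≤ i ≤ n - 1`, and at least one of `c_{i-1}, c_i` is not between
`c_{i-2}, c_{i+1}` for `3 ≤ i ≤ n - 1`. (In the code, positions are counted from `0`.) -/
def Word.IsZigzag {d : ℕ} (w : Word d) : Prop :=
  (∀ (m : ℕ) (h : m + 2 < w.1.length),
    ¬ Between w.1[m].index w.1[m + 2].index w.1[m + 1].index) ∧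
  (∀ (m : ℕ) (h : m + 3 < w.1.length),
    ¬ Between w.1[m].index w.1[m + 3].index w.1[m + 1].index ∨
    ¬ Between w.1[m].index w.1[m + 3].index w.1[m + 2].index)

/-- `Z_λ`: the span of the zigzag words of type `λ`. -/
def zigzagSpan {d : ℕ} (F : Type*) [Field F] (lam : WordType d) : Submodule F (TCheck d F) :=
  Submodule.span F {x | ∃ w : Word d, w.IsZigzag ∧ w.type = lam ∧ w.toTCheck F = x}

/-- The relators of `Ť`: the elements `u a*^k v`, where `u`, `v` are nontrivial words, `u` ends with
a nonstarred generator of index `i`, `v` begins with a nonstarred generator of index `j`, and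
`0 ≤ k < |i - j|`; and likewise the elements `u a^k v`, with starred generators instead. -/
inductive IsRelator {d : ℕ} {F : Type*} [Field F] (p : Params d F) : TCheck d F → Prop where
  | plain (u v : Word d) (k : ℕ) (i j : Fin (d + 1))
      (hu : u.1.getLast? = some (Gen.plain i)) (hv : v.1.head? = some (Gen.plain j))
      (hk : (k : ℤ) < |(i : ℤ) - (j : ℤ)|) :
      IsRelator p (u.toTCheck F * TCheck.aStarPow p k * v.toTCheck F)
  | star (u v : Word d) (k : ℕ) (i j : Fin (d + 1))
      (hu : u.1.getLast? = some (Gen.star i)) (hv : v.1.head? = some (Gen.star j))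
      (hk : (k : ℤ) < |(i : ℤ) - (j : ℤ)|) :
      IsRelator p (u.toTCheck F * TCheck.aPow p k * v.toTCheck F)

/-- `R_λ`: the span of the `λ`-homogeneous relators. -/
def relatorSpan {d : ℕ} {F : Type*} [Field F] (p : Params d F) (lam : WordType d) :
    Submodule F (TCheck d F) :=
  Submodule.span F {x | IsRelator p x ∧ x ∈ TCheck.component F lam}

/-- The type `λ` is `(p, F)`-direct when the sum `R_λ + Z_λ` is direct. -/
def IsDirect {d : ℕ} {F : Type*} [Field F] (p : Params d F) (lam : WordType d) : Prop :=
  Disjoint (relatorSpan p lam) (zigzagSpan F lam)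

/-- The sequence `ε*_0, ε_0, ε*_0, ε_0, …, ε*_0` with `n` nonstarred and `n + 1` starred terms. -/
def bracketList (d : ℕ) : ℕ → List (Gen d)
  | 0 => [Gen.star 0]
  | n + 1 => Gen.star 0 :: Gen.plain 0 :: bracketList d n

theorem bracketList_isChain (d : ℕ) : ∀ n, (bracketList d n).IsChain Gen.Alternating
  | 0 => by simp [bracketList]
  | 1 => by simp [bracketList, Gen.Alternating, Gen.starred]
  | n + 2 => by
    have h := bracketList_isChain d (n + 1)
    simp only [bracketList, List.isChain_cons_cons] at h ⊢
    exact ⟨by simp [Gen.Alternating, Gen.starred], by simp [Gen.Alternating, Gen.starred], h⟩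

/-- The type `[n]`: the unique type that begins and ends with `ε*_0` and has nonstar-length `n`. -/
def bracketType (d n : ℕ) : WordType d := Word.type ⟨bracketList d n, bracketList_isChain d n⟩

/-! ### The algebra `T̃` and its corner `ε*_0 T̃ ε*_0` -/

/-- The defining relations of `T̃`. -/
inductive TTildeRel {d : ℕ} {F : Type*} [Field F] (p : Params d F) :
    FreeAlgebra F (Gen d) → FreeAlgebra F (Gen d) → Prop where
  | plain (i j : Fin (d + 1)) : TTildeRel p
      (FreeAlgebra.ι F (Gen.plain i) * FreeAlgebra.ι F (Gen.plain j))
      (if i = j then FreeAlgebra.ι F (Gen.plain i) else 0)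
  | star (i j : Fin (d + 1)) : TTildeRel p
      (FreeAlgebra.ι F (Gen.star i) * FreeAlgebra.ι F (Gen.star j))
      (if i = j then FreeAlgebra.ι F (Gen.star i) else 0)
  | starPlainStar (i j : Fin (d + 1)) (k : ℕ) (hk : (k : ℤ) < |(i : ℤ) - (j : ℤ)|) :
      TTildeRel p 0
      (∑ l, p.th l ^ k • (FreeAlgebra.ι F (Gen.star i) * FreeAlgebra.ι F (Gen.plain l) *
        FreeAlgebra.ι F (Gen.star j)))
  | plainStarPlain (i j : Fin (d + 1)) (k : ℕ) (hk : (k : ℤ) < |(i : ℤ) - (j : ℤ)|) :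
      TTildeRel p 0
      (∑ l, p.ths l ^ k • (FreeAlgebra.ι F (Gen.plain i) * FreeAlgebra.ι F (Gen.star l) *
        FreeAlgebra.ι F (Gen.plain j)))

/-- The algebra `T̃ = T̃(p, F)`. -/
abbrev TTilde {d : ℕ} {F : Type*} [Field F] (p : Params d F) : Type _ := RingQuot (TTildeRel p)

/-- The idempotent generators of `T̃`. -/
def TTilde.gen {d : ℕ} {F : Type*} [Field F] (p : Params d F) (g : Gen d) : TTilde p :=
  RingQuot.mkAlgHom F (TTildeRel p) (FreeAlgebra.ι F g)

theorem TTilde.isIdempotentElem_star_zero {d : ℕ} {F : Type*} [Field F] (p : Params d F) :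
    IsIdempotentElem (TTilde.gen p (Gen.star 0)) := by
  have h := RingQuot.mkAlgHom_rel F (TTildeRel.star (p := p) 0 0)
  rw [if_pos rfl, map_mul] at h
  exact h

/-- The corner `e A e` of an `F`-algebra `A` at an idempotent `e` is an `F`-algebra with identity
`e`, the scalars acting as they do on `A`. -/
instance cornerAlgebra {F A : Type*} [Field F] [Ring A] [Algebra F A] {e : A}
    (he : IsIdempotentElem e) : Algebra F he.Corner where
  smul c x := ⟨c • x.1, c • x.1, by
    have h := (Subsemigroup.mem_corner_iff he).mp x.2
    simp [h.1, h.2]⟩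
  algebraMap :=
    { toFun := fun c => ⟨c • e, c • e, by simp [he.eq]⟩
      map_one' := Subtype.ext (one_smul F e)
      map_mul' := fun a b => Subtype.ext (by
        change (a * b) • e = (a • e) * (b • e)
        rw [smul_mul_smul_comm, he.eq])
      map_zero' := Subtype.ext (zero_smul F e)
      map_add' := fun a b => Subtype.ext (add_smul a b e) }
  commutes' c x := Subtype.ext (by
    have h := (Subsemigroup.mem_corner_iff he).mp x.2
    change (c • e) * x.1 = x.1 * (c • e)
    rw [smul_mul_assoc, mul_smul_comm, h.1, h.2])
  smul_def' c x := Subtype.ext (by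
    have h := (Subsemigroup.mem_corner_iff he).mp x.2
    change c • x.1 = (c • e) * x.1
    rw [smul_mul_assoc, h.1])

/-- The algebra `ε*_0 T̃ ε*_0`. -/
abbrev TTildeCorner {d : ℕ} {F : Type*} [Field F] (p : Params d F) : Type _ :=
  (TTilde.isIdempotentElem_star_zero p).Corner

/-- The element `ε*_0 ε_i ε*_0` of `ε*_0 T̃ ε*_0`. -/
def cornerGen {d : ℕ} {F : Type*} [Field F] (p : Params d F) (i : Fin (d + 1)) : TTildeCorner p :=
  ⟨TTilde.gen p (Gen.star 0) * TTilde.gen p (Gen.plain i) * TTilde.gen p (Gen.star 0),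
    TTilde.gen p (Gen.plain i), rfl⟩

end SharpTD

end

noncomputable section

/-! The elements `cornerGen p i` commute and generate the corner. Hence ν exists and is surjective
for every feasible `p`, and the equivalence concerns only its injectivity.

Everything proved inside T̃ rests on a Vandermonde argument (`mem_of_moments`): a family with r
vanishing moments and at most r possibly nonzero terms is zero. The relations of T̃ say that
inserting a letter between two letters of the other kind, with indices i and j, gives a family with
|i - j| vanishing moments. For commutation (`cornerGen_comm`), this kills the antisymmetrized words
through ε*_j for j > 0, and a zeroth moment then settles j = 0. For generation (`adjoin_cornerGen`),
words starting from ε*_0 are rewritten through vectors that behave like members of a split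
decomposition. Raising such a vector by ∏ (a - θ_h) gives another one, and `mem_tail_of_isSplit`
inducts along these raisings.

For injectivity, Ť has the words as a basis, and T̃ is Ť modulo the span of the relators, so this
span can be studied type by type. The zigzag words of type [n] are exactly ε*_0 ε_{i_1} ε*_0 ⋯
ε_{i_n} ε*_0 with i_1 ≥ ⋯ ≥ i_n, that is, the monomials of degree n. Thus `polyLift` carries the
kernel of ν, degree by degree, onto the intersections of R_[n] and Z_[n]. -/

namespace SharpTD

/-! ### Vandermonde arguments for families and grids of vectors. -/

section Moments

variable {F : Type*} [Field F] {E : Type*} [AddCommGroup E] [Module F E] {d : ℕ}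

theorem sum_eval_smul_mem {ι : Type*} [Fintype ι] {t : ι → F} {f : ι → E} {N : Submodule F E}
    {r : ℕ} (h : ∀ k < r, ∑ i, t i ^ k • f i ∈ N) {q : Polynomial F} (hq : q.natDegree < r) :
    ∑ i, q.eval (t i) • f i ∈ N := by
  have : ∑ i, q.eval (t i) • f i =
      ∑ k ∈ Finset.range (q.natDegree + 1), q.coeff k • ∑ i, t i ^ k • f i := by
    simp_rw [Finset.smul_sum]
    rw [Finset.sum_comm]
    refine Finset.sum_congr rfl fun i _ => ?_
    rw [Polynomial.eval_eq_sum_range, Finset.sum_smul]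
    simp_rw [mul_smul]
  rw [this]
  refine N.sum_mem fun k hk => N.smul_mem _ (h k ?_)
  have := Finset.mem_range.mp hk
  omega

/-- A family supported, modulo `N`, on at most `r` points whose first `r` moments lie in `N`
lies in `N`. -/
theorem mem_of_moments {ι : Type*} [Fintype ι] {t : ι → F} (ht : Function.Injective t) {f : ι → E}
    {N : Submodule F E} {r : ℕ} (h : ∀ k < r, ∑ i, t i ^ k • f i ∈ N) (S : Finset ι)
    (hS : ∀ i ∉ S, f i ∈ N) (hr : S.card ≤ r) (i : ι) : f i ∈ N := by
  classical
  by_cases hi : i ∈ S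
  swap
  · exact hS i hi
  -- Lagrange interpolation: `q` vanishes at every point of `S` except `i` and has degree `S.card -
  -- 1 < r`, so modulo `N` it leaves only a nonzero multiple of `f i`.
  set q : Polynomial F := ∏ j ∈ S.erase i, (Polynomial.X - Polynomial.C (t j)) with hq
  have hdeg : q.natDegree < r := by
    rw [hq, Polynomial.natDegree_finsetProd_X_sub_C_eq_card, Finset.card_erase_of_mem hi]
    have := Finset.card_pos.mpr ⟨i, hi⟩
    omega
  have hsum := sum_eval_smul_mem h hdeg
  rw [← Finset.add_sum_erase _ _ (Finset.mem_univ i)] at hsum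
  have hrest : ∑ j ∈ Finset.univ.erase i, q.eval (t j) • f j ∈ N := by
    refine N.sum_mem fun j hj => ?_
    by_cases hjS : j ∈ S
    · have : q.eval (t j) = 0 := by
        rw [hq, Polynomial.eval_prod]
        exact Finset.prod_eq_zero (Finset.mem_erase.mpr ⟨Finset.ne_of_mem_erase hj, hjS⟩)
          (by simp)
      simp [this]
    · exact N.smul_mem _ (hS j hjS)
  have hmem := (N.add_mem_iff_left hrest).mp hsum
  refine (N.smul_mem_iff ?_).mp hmem
  rw [hq, Polynomial.eval_prod, Finset.prod_ne_zero_iff]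
  intro j hj
  simpa [sub_eq_zero] using fun hij => Finset.ne_of_mem_erase hj (ht hij).symm

theorem mem_of_moments_interval {t : Fin (d + 1) → F} (ht : Function.Injective t)
    {f : Fin (d + 1) → E} {N : Submodule F E} {r : ℕ} (h : ∀ k < r, ∑ i, t i ^ k • f i ∈ N)
    (a b : ℕ) (hab : b ≤ a + r) (hS : ∀ i : Fin (d + 1), (i : ℕ) < a ∨ b ≤ (i : ℕ) → f i ∈ N)
    (i : Fin (d + 1)) : f i ∈ N := by
  refine mem_of_moments ht h (Finset.univ.filter fun i : Fin (d + 1) => a ≤ i.val ∧ i.val < b)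
    (fun i hi => hS i ?_) ?_ i
  · simp only [Finset.mem_filter, Finset.mem_univ, true_and, not_and, not_lt] at hi
    by_cases h : (i : ℕ) < a
    · exact Or.inl h
    · exact Or.inr (hi (not_lt.mp h))
  · calc _ = ((Finset.univ.filter fun i : Fin (d + 1) => a ≤ i.val ∧ i.val < b).map
          Fin.valEmbedding).card := (Finset.card_map _).symm
      _ ≤ (Finset.Ico a b).card := Finset.card_le_card fun x hx => by
          simp only [Finset.mem_map, Finset.mem_filter, Finset.mem_univ, true_and] at hx
          obtain ⟨y, hy, rfl⟩ := hx
          exact Finset.mem_Ico.mpr hy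
      _ ≤ r := by simp; omega

/-- A grid of vectors whose columns and rows satisfy the moment conditions of words
`ε*_i ε_l ε*_j ε_m` with `i ≤ v` lies in `N` as soon as its entries with `m ≤ l`, `j ≤ m` and those
with `l < v` or `j < v` do. -/
theorem grid_mem {t s : Fin (d + 1) → F} (ht : Function.Injective t) (hs : Function.Injective s)
    {N : Submodule F E} {f : Fin (d + 1) → Fin (d + 1) → E} {v m : ℕ} (hvm : v ≤ m) (hmd : m ≤ d)
    (hl : ∀ l j : Fin (d + 1), (l : ℕ) < v → f l j ∈ N)
    (hj : ∀ l j : Fin (d + 1), (j : ℕ) < v → f l j ∈ N)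
    (hlj : ∀ l j : Fin (d + 1), m ≤ (l : ℕ) → (j : ℕ) ≤ m → f l j ∈ N)
    (hcol : ∀ (j : Fin (d + 1)) (k : ℕ), v + k < j → ∑ l, t l ^ k • f l j ∈ N)
    (hrow : ∀ (l : Fin (d + 1)) (k : ℕ), (k : ℤ) < |(l : ℤ) - (m : ℤ)| →
      ∑ j, s j ^ k • f l j ∈ N)
    (l j : Fin (d + 1)) : f l j ∈ N := by
  -- Indices d, d - 1, …, m + 1 are peeled off both axes. Row d - c has unknown entries for m < j ≤
  -- d - c, as many as its d - c - m moments. After that, column d - c has unknown entries for v ≤ l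
  -- < d - c, as many as its d - c - v moments.
  have high : ∀ c : ℕ, m + c ≤ d → ∀ l j : Fin (d + 1),
      d + 1 - c ≤ (l : ℕ) ∨ d + 1 - c ≤ (j : ℕ) → f l j ∈ N := by
    intro c
    induction c with
    | zero => intro _ l j h; omega
    | succ c ih =>
      intro hc
      have ih := ih (by omega)
      have hr : ∀ l j : Fin (d + 1), (l : ℕ) = d - c → f l j ∈ N := by
        intro l j hl'
        refine mem_of_moments_interval hs (r := d - c - m) (fun k hk => hrow l k ?_) (m + 1)
          (d - c + 1) (by omega) (fun j hj' => ?_) j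
        · rw [hl', abs_of_nonneg (by omega)]; omega
        · rcases hj' with hj' | hj'
          · exact hlj l j (by omega) (by omega)
          · exact ih l j (Or.inr (by omega))
      have hcl : ∀ l j : Fin (d + 1), (j : ℕ) = d - c → f l j ∈ N := by
        intro l j hj'
        refine mem_of_moments_interval ht (f := fun l => f l j) (r := d - c - v)
          (fun k hk => hcol j k (by omega)) v (d - c) (by omega) (fun l hl' => ?_) l
        rcases hl' with hl' | hl'
        · exact hl l j hl'
        · by_cases h : (l : ℕ) = d - c
          · exact hr l j h
          · exact ih l j (Or.inl (by omega))
      intro l j h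
      by_cases h1 : d + 1 - c ≤ (l : ℕ) ∨ d + 1 - c ≤ (j : ℕ)
      · exact ih l j h1
      by_cases h2 : (l : ℕ) = d - c
      · exact hr l j h2
      · exact hcl l j (by omega)
  have hrows : ∀ l j : Fin (d + 1), m ≤ (l : ℕ) → f l j ∈ N := by
    intro l j h
    by_cases hjm : (j : ℕ) ≤ m
    · exact hlj l j h hjm
    · exact high (d - m) (by omega) l j (Or.inr (by omega))
  have hcols : ∀ l j : Fin (d + 1), m < (j : ℕ) → f l j ∈ N :=
    fun l j h => high (d - m) (by omega) l j (Or.inr (by omega))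
  -- What remains is v ≤ l < m, v ≤ j ≤ m. It is exhausted by column m - c and then row v + c, each
  -- with m - v - c unknown entries and as many moments.
  have low : ∀ c : ℕ, v + c ≤ m → ∀ l j : Fin (d + 1),
      (l : ℕ) < v + c ∨ m - c < (j : ℕ) → f l j ∈ N := by
    intro c
    induction c with
    | zero =>
      intro _ l j h
      rcases h with h | h
      · exact hl l j (by omega)
      · exact hcols l j (by omega)
    | succ c ih =>
      intro hc
      have ih := ih (by omega)
      have hcl : ∀ l j : Fin (d + 1), (j : ℕ) = m - c → f l j ∈ N := by
        intro l j hj'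
        refine mem_of_moments_interval ht (f := fun l => f l j) (r := m - c - v)
          (fun k hk => hcol j k (by omega)) (v + c) m (by omega) (fun l hl' => ?_) l
        rcases hl' with hl' | hl'
        · exact ih l j (Or.inl hl')
        · exact hrows l j hl'
      have hr : ∀ l j : Fin (d + 1), (l : ℕ) = v + c → f l j ∈ N := by
        intro l j hl'
        refine mem_of_moments_interval hs (r := m - v - c) (fun k hk => hrow l k ?_) v
          (m - c) (by omega) (fun j hj' => ?_) j
        · rw [hl', abs_of_nonpos (by omega)]; omega
        · rcases hj' with hj' | hj'
          · exact hj l j hj'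
          · by_cases h : (j : ℕ) = m - c
            · exact hcl l j h
            · exact ih l j (Or.inr (by omega))
      intro l j h
      by_cases h1 : (l : ℕ) < v + c ∨ m - c < (j : ℕ)
      · exact ih l j h1
      by_cases h2 : (l : ℕ) = v + c
      · exact hr l j h2
      · exact hcl l j (by omega)
  by_cases h1 : (l : ℕ) < m
  · exact low (m - v) (by omega) l j (Or.inl (by omega))
  · exact hrows l j (by omega)

end Moments

/-! ### Split vectors and the reduction of words to products of corner generators. -/

section Phases

variable {F : Type*} [Field F] {A : Type*} [Ring A] [Algebra F A] {d : ℕ}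

/-- A sequence of families of orthogonal idempotents, of period two, in which consecutive families
satisfy the tridiagonal relations. -/
structure IsPhases (g : ℕ → Fin (d + 1) → A) (t : ℕ → Fin (d + 1) → F) : Prop where
  period : ∀ n, g (n + 2) = g n
  period_scalar : ∀ n, t (n + 2) = t n
  inj : ∀ n, Function.Injective (t n)
  orth : ∀ n i j, g n i * g n j = if i = j then g n i else 0
  rel : ∀ n (i j : Fin (d + 1)) (k : ℕ), (k : ℤ) < |(i : ℤ) - (j : ℤ)| →
    ∑ l, t (n + 1) l ^ k • (g n i * g (n + 1) l * g n j) = 0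

/-- The elements `z` such that `z x_1 ⋯ x_r e ∈ W` whenever `x_1, …, x_r` are taken from the
families of index `n, …, n + r - 1`. -/
def tail (g : ℕ → Fin (d + 1) → A) (W : Submodule F A) (e : A) : ℕ → ℕ → Submodule F A
  | 0, _ => W.comap (LinearMap.mulRight F e)
  | r + 1, n => ⨅ i, (tail g W e r (n + 1)).comap (LinearMap.mulRight F (g n i))

/-- The span of the products `e x_1 ⋯ x_n` with `x_i` taken from the family of index `i - 1`. -/
def head (F : Type*) [Field F] {A : Type*} [Ring A] [Algebra F A] (g : ℕ → Fin (d + 1) → A)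
    (e : A) : ℕ → Submodule F A
  | 0 => Submodule.span F {e}
  | n + 1 => ⨆ i, (head F g e n).map (LinearMap.mulRight F (g n i))

variable {g : ℕ → Fin (d + 1) → A} {t : ℕ → Fin (d + 1) → F} {W : Submodule F A} {e : A}

theorem mem_tail_zero {n : ℕ} {z : A} : z ∈ tail g W e 0 n ↔ z * e ∈ W := Iff.rfl

theorem mem_tail_succ {r n : ℕ} {z : A} :
    z ∈ tail g W e (r + 1) n ↔ ∀ i, z * g n i ∈ tail g W e r (n + 1) := by
  simp [tail]

theorem mul_mem_head {n : ℕ} {z : A} (hz : z ∈ head F g e n) (i : Fin (d + 1)) :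
    z * g n i ∈ head F g e (n + 1) :=
  Submodule.mem_iSup_of_mem i ⟨z, hz, rfl⟩

theorem head_le_tail {r : ℕ} (n : ℕ) (h : e ∈ tail g W e (r + n) 0) :
    head F g e n ≤ tail g W e r n := by
  induction n generalizing r with
  | zero => simpa [head, Submodule.span_le] using h
  | succ n ih =>
    refine iSup_le fun i => Submodule.map_le_iff_le_comap.mpr fun z hz => ?_
    exact mem_tail_succ.mp (ih (r := r + 1) (by rwa [Nat.succ_add_eq_add_succ]) hz) i

/-- `y` lies in the `v`-th component of the split decomposition before phase `n`. -/
structure IsSplit (g : ℕ → Fin (d + 1) → A) (n v : ℕ) (y : A) : Prop where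
  lower : ∀ l : Fin (d + 1), (l : ℕ) < v → y * g n l = 0
  sum : y = ∑ i, y * g (n + 1) i
  upper : ∀ i : Fin (d + 1), v < (i : ℕ) → y * g (n + 1) i.rev = 0

/-- In the expansion of `y` along family `n + 1`, only indices whose reverse is at most `v` survive.
These are at distance at least `j - v > k` from `j.rev`, so the relations kill each term. -/
theorem IsSplit.column (hg : IsPhases g t) {n v : ℕ} {y : A} (hy : IsSplit g n v y)
    (j : Fin (d + 1)) (k : ℕ) (hk : v + k < j) :
    ∑ l, t n l ^ k • (y * g n l * g (n + 1) j.rev) = 0 := by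
  have hterm : ∀ i l : Fin (d + 1), t n l ^ k • (y * g (n + 1) i * g n l * g (n + 1) j.rev) =
      y * (t n l ^ k • (g (n + 1) i * g n l * g (n + 1) j.rev)) := fun i l => by
    rw [mul_smul_comm]; simp only [mul_assoc]
  calc _ = ∑ l, ∑ i, t n l ^ k • (y * g (n + 1) i * g n l * g (n + 1) j.rev) := by
        refine Finset.sum_congr rfl fun l _ => ?_
        rw [← Finset.smul_sum, ← Finset.sum_mul, ← Finset.sum_mul, ← hy.sum]
    _ = ∑ i, ∑ l, t n l ^ k • (y * g (n + 1) i * g n l * g (n + 1) j.rev) := Finset.sum_comm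
    _ = 0 := Finset.sum_eq_zero fun i _ => by
        by_cases hi : v < (i.rev : ℕ)
        · have := hy.upper i.rev hi
          rw [Fin.rev_rev] at this
          simp [this]
        · simp_rw [hterm, ← Finset.mul_sum]
          have := hg.rel (n + 1) i j.rev k (by
            have h1 := Fin.val_rev i
            have h2 := Fin.val_rev j
            rw [lt_abs]; omega)
          have hper : t (n + 1 + 1) = t n := hg.period_scalar n
          rw [hper, show n + 1 + 1 = n + 2 from rfl, hg.period] at this
          rw [this, mul_zero]

theorem IsSplit.row (hg : IsPhases g t) {n : ℕ} (y : A)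
    (l m : Fin (d + 1)) (k : ℕ) (hk : (k : ℤ) < |(l : ℤ) - (m : ℤ)|) :
    ∑ j : Fin (d + 1), t (n + 1) j.rev ^ k • (y * g n l * g (n + 1) j.rev * g n m) = 0 := by
  have := hg.rel n l m k hk
  rw [← Equiv.sum_comp Fin.revPerm] at this
  calc _ = y * ∑ j : Fin (d + 1), t (n + 1) j.rev ^ k • (g n l * g (n + 1) j.rev * g n m) := by
        rw [Finset.mul_sum]
        refine Finset.sum_congr rfl fun j _ => ?_
        rw [mul_smul_comm]; simp only [mul_assoc]
    _ = 0 := by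
        simp only [Fin.revPerm_apply] at this
        rw [this, mul_zero]

/-- This is `grid_mem` for the three-letter continuations of `y`: columns get their moments from
`IsSplit.column`, rows from the relation between the two outer letters. -/
theorem IsSplit.straighten (hg : IsPhases g t) {n v : ℕ} {y : A} (hy : IsSplit g n v y)
    (N : Submodule F A) (m : Fin (d + 1)) (hvm : v ≤ m)
    (hj : ∀ l j : Fin (d + 1), (j : ℕ) < v → y * g n l * g (n + 1) j.rev * g n m ∈ N)
    (hl : ∀ l j : Fin (d + 1), m ≤ l → j ≤ m → y * g n l * g (n + 1) j.rev * g n m ∈ N)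
    (l j : Fin (d + 1)) : y * g n l * g (n + 1) j * g n m ∈ N := by
  rw [← Fin.rev_rev j]
  refine grid_mem (hg.inj n) ((hg.inj (n + 1)).comp Fin.rev_injective)
    (f := fun l j => y * g n l * g (n + 1) j.rev * g n m) hvm (by omega)
    (fun l j h => ?_) hj (fun l j h1 h2 => hl l j h1 h2) (fun j k hk => ?_) (fun l k hk => ?_)
    l j.rev
  · simp only [hy.lower l h, zero_mul, N.zero_mem]
  · have := congrArg (· * g n m) (hy.column hg j k hk)
    simp only [Finset.sum_mul, zero_mul, smul_mul_assoc] at this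
    simp only [this, N.zero_mem]
  · simp only [Function.comp, IsSplit.row hg y l m k hk, N.zero_mem]

/-- The polynomial `∏_{v ≤ h < u} (X - t_h)`. -/
def riser (t : Fin (d + 1) → F) (v u : ℕ) : Polynomial F :=
  ∏ h : Fin (d + 1) with v ≤ h.val ∧ h.val < u, (Polynomial.X - Polynomial.C (t h))

theorem riser_natDegree_le (t : Fin (d + 1) → F) (v u : ℕ) :
    (riser t v u).natDegree ≤ u - v := by
  rw [riser, Polynomial.natDegree_finsetProd_X_sub_C_eq_card]
  calc _ = ((Finset.univ.filter fun i : Fin (d + 1) => v ≤ i.val ∧ i.val < u).map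
          Fin.valEmbedding).card := (Finset.card_map _).symm
    _ ≤ (Finset.Ico v u).card := Finset.card_le_card fun x hx => by
        simp only [Finset.mem_map, Finset.mem_filter, Finset.mem_univ, true_and] at hx
        obtain ⟨y, hy, rfl⟩ := hx
        exact Finset.mem_Ico.mpr hy
    _ = u - v := by simp

theorem riser_eval_eq_zero {t : Fin (d + 1) → F} {v u : ℕ} {l : Fin (d + 1)} (h1 : v ≤ l)
    (h2 : (l : ℕ) < u) : (riser t v u).eval (t l) = 0 := by
  rw [riser, Polynomial.eval_prod]
  exact Finset.prod_eq_zero (i := l) (by simp [h1, h2]) (by simp)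

theorem riser_eval_ne_zero {t : Fin (d + 1) → F} (ht : Function.Injective t) (v : ℕ)
    (u : Fin (d + 1)) : (riser t v u).eval (t u) ≠ 0 := by
  rw [riser, Polynomial.eval_prod, Finset.prod_ne_zero_iff]
  intro h hh
  simp only [Finset.mem_filter, Finset.mem_univ, true_and] at hh
  simp only [Polynomial.eval_sub, Polynomial.eval_X, Polynomial.eval_C, ne_eq, sub_eq_zero]
  intro heq
  have := ht heq
  omega

/-- Raise `y` from level `v` to level `u` in phase `n`. -/
def raise (g : ℕ → Fin (d + 1) → A) (t : ℕ → Fin (d + 1) → F) (n v u : ℕ) (y : A) : A :=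
  ∑ l, (riser (t n) v u).eval (t n l) • (y * g n l)

/-- A split vector of level `u` meets one family only in indices at least `u` and the other only in
reversed indices at most `u`. Passing to the next phase exchanges these conditions, turning level
`u` into `d - u`. The degree of `riser` is small enough for the column relations to apply, and its
zeros remove the indices from `v` to `u - 1`. -/
theorem isSplit_raise (hg : IsPhases g t) {n v : ℕ} {y : A} (hy : IsSplit g n v y)
    (u : Fin (d + 1)) (hvu : v ≤ u) : IsSplit g (n + 1) (d - u) (raise g t n v u y) := by
  refine ⟨fun l hl => ?_, ?_, fun i hi => ?_⟩
  · have hlr := Fin.val_rev l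
    have h : ∀ k < (l.rev : ℕ) - v, ∑ i, t n i ^ k • (y * g n i * g (n + 1) l) ∈
        (⊥ : Submodule F A) := fun k hk => by
      have := hy.column hg l.rev k (by omega)
      rwa [Fin.rev_rev] at this
    have := sum_eval_smul_mem h (q := riser (t n) v u)
      ((riser_natDegree_le _ _ _).trans_lt (by omega))
    rw [Submodule.mem_bot] at this
    simpa only [SharpTD.raise, Finset.sum_mul, smul_mul_assoc] using this
  · rw [show n + 1 + 1 = n + 2 from rfl, hg.period]
    simp only [SharpTD.raise, Finset.sum_mul, smul_mul_assoc, mul_assoc, hg.orth]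
    rw [Finset.sum_comm]
    simp
  · have hir := Fin.val_rev i
    rw [show n + 1 + 1 = n + 2 from rfl, hg.period]
    simp only [SharpTD.raise, Finset.sum_mul, smul_mul_assoc, mul_assoc, hg.orth, mul_ite, mul_zero,
      smul_ite, smul_zero, Finset.sum_ite_eq', Finset.mem_univ, if_true]
    by_cases hv : v ≤ (i.rev : ℕ)
    · rw [riser_eval_eq_zero hv (by omega), zero_smul]
    · rw [hy.lower _ (by omega), smul_zero]

/-- Raising is triangular: terms below `u` vanish and the coefficient at `u` is nonzero. -/
theorem IsSplit.mul_mem_of_raise_mem (hg : IsPhases g t) {n v : ℕ} {y : A} (hy : IsSplit g n v y)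
    {N : Submodule F A} (u : Fin (d + 1)) (hu : ∀ l, u < l → y * g n l ∈ N)
    (hr : raise g t n v u y ∈ N) : y * g n u ∈ N := by
  rw [SharpTD.raise, ← Finset.add_sum_erase _ _ (Finset.mem_univ u)] at hr
  have hrest : ∑ l ∈ Finset.univ.erase u, (riser (t n) v u).eval (t n l) • (y * g n l) ∈ N := by
    refine N.sum_mem fun l hl => ?_
    rcases lt_or_gt_of_ne (Finset.ne_of_mem_erase hl) with h | h
    · by_cases hv : v ≤ (l : ℕ)
      · rw [riser_eval_eq_zero hv h, zero_smul]; exact N.zero_mem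
      · rw [hy.lower _ (by omega), smul_zero]; exact N.zero_mem
    · exact N.smul_mem _ (hu l h)
  exact (N.smul_mem_iff (riser_eval_ne_zero (hg.inj n) v u)).mp ((N.add_mem_iff_left hrest).mp hr)

theorem raise_mem_head {n v u : ℕ} {y : A} (hy : y ∈ head F g e n) :
    raise g t n v u y ∈ head F g e (n + 1) :=
  Submodule.sum_mem _ fun i _ => Submodule.smul_mem _ _ (mul_mem_head hy i)

/-- Core of the generation argument, by induction on the number of letters still to follow `y`. For
`u` from `d` downwards, `y * g n u` is traded for the raised vector, which is split one phase later
and has one letter fewer after it. `hK` is what is known about shorter words; `hj` is the invariant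
that feeds `straighten`. -/
theorem mem_tail_of_isSplit (hg : IsPhases g t) (hW : ∀ x ∈ W, ∀ y ∈ W, x * y ∈ W)
    (he : e = g 1 (Fin.last d)) (heW : ∀ l, e * g 0 l * e ∈ W) (s : ℕ) :
    ∀ (n v : ℕ) (y : A), Odd (n + s) → v ≤ d → IsSplit g n v y → y ∈ head F g e n →
      (∀ l j : Fin (d + 1), (j : ℕ) < v → y * g n l * g (n + 1) j.rev ∈ tail g W e s (n + 2)) →
      (∀ z ∈ head F g e (n + s), z * e ∈ W) → y ∈ tail g W e (s + 2) n := by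
  have hee : e * e = e := by rw [he, hg.orth, if_pos rfl]
  have hodd : ∀ k, g (2 * k + 1) = g 1 := fun k => by
    induction k with
    | zero => rfl
    | succ k ih => rw [← ih, ← hg.period (2 * k + 1)]; rfl
  have heven : ∀ k, g (2 * k) = g 0 := fun k => by
    induction k with
    | zero => rfl
    | succ k ih => rw [← ih, ← hg.period (2 * k)]; rfl
  induction s with
  | zero =>
    rintro n v y ⟨k, hk⟩ hvd hy hh hj hK
    rw [add_zero] at hk hK
    have hgn : g n (Fin.last d) = e := by rw [hk, hodd, he]
    refine mem_tail_succ.mpr fun l => mem_tail_succ.mpr fun j => mem_tail_zero.mpr ?_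
    rw [← hgn]
    refine hy.straighten hg W (Fin.last d) hvd (fun l j h => ?_) (fun l j h1 _ => ?_) l j
    · rw [hgn]
      exact hj l j h
    -- Here the letter after `y` is `e` itself, so the word factors as `(y * e) * (e * g 0 j.rev *
    -- e)`.
    · rw [Fin.last_le_iff.mp h1, hgn]
      have := hW _ (hK y hh) _ (heW j.rev)
      rwa [← mul_assoc, ← mul_assoc, mul_assoc y, hee, ← heven (k + 1),
        show 2 * (k + 1) = n + 1 by omega] at this
  | succ s ih =>
    intro n v y hodd' hvd hy hh hj hK
    refine mem_tail_succ.mpr fun l => ?_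
    by_cases hlv : (l : ℕ) < v
    · rw [hy.lower l hlv]; exact Submodule.zero_mem _
    induction l using WellFoundedGT.induction with
    | ind u hu =>
    refine hy.mul_mem_of_raise_mem hg u (fun l hl => hu l hl (by omega)) ?_
    refine ih (n + 1) (d - u) _ (by rwa [Nat.succ_add_eq_add_succ]) (Nat.sub_le _ _)
      (isSplit_raise hg hy u (by omega)) (raise_mem_head hh) (fun l j hju => ?_)
      (by rwa [Nat.succ_add_eq_add_succ])
    have hjr := Fin.val_rev j
    -- The invariant for the raised vector. As `j < d - u`, the closing letter has index `j.rev >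
    -- u`. Continuations whose first index is at least `j.rev` are covered by the downward induction
    -- `hu`, and those with a small middle index by `hj`.
    have hmem : ∀ l', y * g n l' * g (n + 1) l * g n j.rev ∈ tail g W e s (n + 3) := fun l' => by
      refine hy.straighten hg _ j.rev (by omega) (fun a b hb => ?_) (fun a b h1 h2 => ?_) l' l
      · have := mem_tail_succ.mp (hj a b hb) j.rev
        rwa [hg.period] at this
      · have := mem_tail_succ.mp (mem_tail_succ.mp
          (hu a (lt_of_lt_of_le (by rw [Fin.lt_def]; omega) h1) (by omega)) b.rev) j.rev
        rwa [show n + 1 + 1 = n + 2 from rfl, hg.period] at this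
    rw [show n + 1 + 1 = n + 2 from rfl, hg.period, SharpTD.raise]
    simp only [Finset.sum_mul, smul_mul_assoc]
    exact Submodule.sum_mem _ fun l' _ => Submodule.smul_mem _ _ (hmem l')

/-- The vector `e` is split of level 0 before phase 0, so the invariant of `mem_tail_of_isSplit`
starts out vacuous. -/
theorem head_mul_mem (hg : IsPhases g t) (hW : ∀ x ∈ W, ∀ y ∈ W, x * y ∈ W)
    (he : e = g 1 (Fin.last d)) (heW : ∀ l, e * g 0 l * e ∈ W) (k : ℕ) :
    ∀ y ∈ head F g e (2 * k + 1), y * e ∈ W := by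
  induction k with
  | zero =>
    intro y hy
    have : head F g e 1 ≤ tail g W e 0 1 := by
      refine head_le_tail 1 (mem_tail_succ.mpr fun l => heW l)
    exact this hy
  | succ k ih =>
    intro y hy
    have hs : IsSplit g 0 0 e := by
      refine ⟨fun l hl => by omega, ?_, fun i hi => ?_⟩
      · subst he
        simp [hg.orth]
      · subst he
        rw [hg.orth, if_neg]
        intro h
        have := congrArg Fin.val h
        simp [Fin.val_rev] at this
        omega
    have := mem_tail_of_isSplit hg hW he heW (2 * k + 1) 0 0 e (by simp) (Nat.zero_le _) hs
      (Submodule.mem_span_singleton_self e) (fun l j h => by omega) (by simpa using ih)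
    exact head_le_tail (r := 0) (2 * (k + 1) + 1) (by convert this using 2; omega) hy

end Phases

/-! ### Submodules stable under multiplication by generators. -/

section RingQuot

variable {F : Type*} [Field F] {X : Type*} {r : FreeAlgebra F X → FreeAlgebra F X → Prop}

theorem mul_mem_of_forall_gen (S : Submodule F (RingQuot r)) {x : RingQuot r} (hx : x ∈ S)
    (hS : ∀ y ∈ S, ∀ h, y * RingQuot.mkAlgHom F r (FreeAlgebra.ι F h) ∈ S) (z : RingQuot r) :
    x * z ∈ S := by
  obtain ⟨z, rfl⟩ := RingQuot.mkAlgHom_surjective F r z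
  induction z using FreeAlgebra.induction generalizing x with
  | grade0 r =>
    rw [AlgHom.commutes, ← Algebra.commutes, ← Algebra.smul_def]
    exact S.smul_mem r hx
  | grade1 h => exact hS x hx h
  | mul a b ha hb =>
    rw [map_mul, ← mul_assoc]
    exact hb (ha hx)
  | add a b ha hb =>
    rw [map_add, mul_add]
    exact S.add_mem (ha hx) (hb hx)

theorem mul_mem_of_forall_gen_left (S : Submodule F (RingQuot r)) {x : RingQuot r} (hx : x ∈ S)
    (hS : ∀ y ∈ S, ∀ h, RingQuot.mkAlgHom F r (FreeAlgebra.ι F h) * y ∈ S) (z : RingQuot r) :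
    z * x ∈ S := by
  obtain ⟨z, rfl⟩ := RingQuot.mkAlgHom_surjective F r z
  induction z using FreeAlgebra.induction generalizing x with
  | grade0 r =>
    rw [AlgHom.commutes, ← Algebra.smul_def]
    exact S.smul_mem r hx
  | grade1 h => exact hS x hx h
  | mul a b ha hb =>
    rw [map_mul, mul_assoc]
    exact ha (hb hx)
  | add a b ha hb =>
    rw [map_add, add_mul]
    exact S.add_mem (ha hx) (hb hx)

end RingQuot

/-! ### Commutation and generation in the corner of T̃. -/

section TTilde

variable {d : ℕ} {F : Type*} [Field F] (p : Params d F)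

theorem TTilde.plain_mul_plain (i j : Fin (d + 1)) :
    TTilde.gen p (.plain i) * TTilde.gen p (.plain j) =
      if i = j then TTilde.gen p (.plain i) else 0 := by
  have h := RingQuot.mkAlgHom_rel F (TTildeRel.plain (p := p) i j)
  rw [map_mul] at h
  refine h.trans ?_
  split_ifs
  · rfl
  · exact map_zero _

theorem TTilde.star_mul_star (i j : Fin (d + 1)) :
    TTilde.gen p (.star i) * TTilde.gen p (.star j) =
      if i = j then TTilde.gen p (.star i) else 0 := by
  have h := RingQuot.mkAlgHom_rel F (TTildeRel.star (p := p) i j)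
  rw [map_mul] at h
  refine h.trans ?_
  split_ifs
  · rfl
  · exact map_zero _

theorem TTilde.sum_star_plain_star (i j : Fin (d + 1)) (k : ℕ)
    (hk : (k : ℤ) < |(i : ℤ) - (j : ℤ)|) :
    ∑ l, p.th l ^ k • (TTilde.gen p (.star i) * TTilde.gen p (.plain l) *
      TTilde.gen p (.star j)) = 0 := by
  have h := RingQuot.mkAlgHom_rel F (TTildeRel.starPlainStar (p := p) i j k hk)
  simp only [map_zero, map_sum, map_smul, map_mul] at h
  exact h.symm

theorem TTilde.sum_plain_star_plain (i j : Fin (d + 1)) (k : ℕ)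
    (hk : (k : ℤ) < |(i : ℤ) - (j : ℤ)|) :
    ∑ l, p.ths l ^ k • (TTilde.gen p (.plain i) * TTilde.gen p (.star l) *
      TTilde.gen p (.plain j)) = 0 := by
  have h := RingQuot.mkAlgHom_rel F (TTildeRel.plainStarPlain (p := p) i j k hk)
  simp only [map_zero, map_sum, map_smul, map_mul] at h
  exact h.symm

variable {p}

/-- The antisymmetrized words `ε*_0 ε_l ε*_j ε_m ε*_0` vanish for `j ≠ 0`. -/
theorem TTilde.word_symm_of_pos (hp : p.Feasible) (c : ℕ) : c ≤ d → ∀ j : Fin (d + 1),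
    d < j + c → ∀ l m : Fin (d + 1),
      TTilde.gen p (.star 0) * TTilde.gen p (.plain l) * TTilde.gen p (.star j) *
          TTilde.gen p (.plain m) * TTilde.gen p (.star 0) =
        TTilde.gen p (.star 0) * TTilde.gen p (.plain m) * TTilde.gen p (.star j) *
          TTilde.gen p (.plain l) * TTilde.gen p (.star 0) := by
  set w : Fin (d + 1) → Fin (d + 1) → Fin (d + 1) → TTilde p := fun l j m =>
    TTilde.gen p (.star 0) * TTilde.gen p (.plain l) * TTilde.gen p (.star j) *
      TTilde.gen p (.plain m) * TTilde.gen p (.star 0) with hw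
  have hleft : ∀ (j m : Fin (d + 1)) (k : ℕ), k < (j : ℕ) → ∑ l, p.th l ^ k • w l j m = 0 := by
    intro j m k hk
    have h := congrArg (· * (TTilde.gen p (.plain m) * TTilde.gen p (.star 0)))
      (TTilde.sum_star_plain_star p 0 j k (by rw [lt_abs]; simp; omega))
    simpa only [Finset.sum_mul, smul_mul_assoc, zero_mul, ← mul_assoc] using h
  have hright : ∀ (l j : Fin (d + 1)) (k : ℕ), k < (j : ℕ) → ∑ m, p.th m ^ k • w l j m = 0 := by
    intro l j k hk
    have h := congrArg ((TTilde.gen p (.star 0) * TTilde.gen p (.plain l)) * ·)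
      (TTilde.sum_star_plain_star p j 0 k (by rw [lt_abs]; simp; omega))
    simpa only [Finset.mul_sum, mul_smul_comm, mul_zero, ← mul_assoc] using h
  have hmid : ∀ (l m : Fin (d + 1)) (k : ℕ), (k : ℤ) < |(l : ℤ) - (m : ℤ)| →
      ∑ j, p.ths j ^ k • w l j m = 0 := by
    intro l m k hk
    have h := congrArg (fun x => TTilde.gen p (.star 0) * x * TTilde.gen p (.star 0))
      (TTilde.sum_plain_star_plain p l m k hk)
    simpa only [Finset.mul_sum, Finset.sum_mul, mul_smul_comm, smul_mul_assoc, mul_zero, zero_mul,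
      ← mul_assoc] using h
  change c ≤ d → ∀ j : Fin (d + 1), d < j + c → ∀ l m : Fin (d + 1), w l j m = w m j l
  clear_value w
  induction c with
  | zero => intro _ j hj; omega
  | succ c ih =>
    intro hc j hj
    by_cases hjc : d < j + c
    · exact ih (by omega) j hjc
    -- Terms with index above `j` cancel by induction, leaving the `j + 1` indices 0, …, `j` against
    -- at least `j + 1` moments.
    have hfar : ∀ l m : Fin (d + 1), (j : ℕ) < |(l : ℤ) - (m : ℤ)| → w l j m - w m j l = 0 := by
      intro l m hlm
      refine (Submodule.mem_bot F).mp (mem_of_moments_interval hp.ths_inj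
        (f := fun j => w l j m - w m j l) (N := ⊥) (r := j + 1) (fun k hk => ?_) 0 (j + 1)
        (by omega) (fun i hi => ?_) j)
      · rw [Submodule.mem_bot]
        simp only [smul_sub, Finset.sum_sub_distrib]
        rw [hmid l m k (by omega), hmid m l k (by rw [abs_sub_comm]; omega), sub_zero]
      · rw [Submodule.mem_bot, ih (by omega) i (by omega), sub_self]
    -- In row `b`, antisymmetry and the earlier rows clear the columns up to `b`, and `hfar` those
    -- beyond `b + j`. The `j` remaining entries face `j` moments.
    have hrow : ∀ b : ℕ, ∀ l m : Fin (d + 1), (l : ℕ) < b → w l j m - w m j l = 0 := by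
      intro b
      induction b with
      | zero => intro l m h; omega
      | succ b ihb =>
        intro l m hl
        by_cases hlb : (l : ℕ) < b
        · exact ihb l m hlb
        refine (Submodule.mem_bot F).mp (mem_of_moments_interval hp.th_inj
          (f := fun m => w l j m - w m j l) (N := ⊥) (r := j) (fun k hk => ?_) (b + 1) (b + 1 + j)
          (by omega) (fun i hi => ?_) m)
        · rw [Submodule.mem_bot]
          simp only [smul_sub, Finset.sum_sub_distrib]
          rw [hright l j k hk, hleft j l k hk, sub_zero]
        · rw [Submodule.mem_bot]
          rcases hi with hi | hi
          · by_cases hib : (i : ℕ) = b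
            · rw [show i = l from Fin.ext (by omega), sub_self]
            · rw [← neg_sub, ihb i l (by omega), neg_zero]
          · exact hfar l i (by rw [lt_abs]; omega)
    exact fun l m => sub_eq_zero.mp (hrow (d + 1) l m l.isLt)

/-- For `l ≠ m` the words ε*_0 ε_l ε*_j ε_m ε*_0 sum to zero over `j`. All terms with `j > 0` are
symmetric in `l` and `m`, hence so is the term `j = 0`. -/
theorem cornerGen_comm (hp : p.Feasible) (l m : Fin (d + 1)) :
    cornerGen p l * cornerGen p m = cornerGen p m * cornerGen p l := by
  by_cases hlm : l = m
  · rw [hlm]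
  have key : TTilde.gen p (.star 0) * TTilde.gen p (.plain l) * TTilde.gen p (.star 0) *
      TTilde.gen p (.plain m) * TTilde.gen p (.star 0) =
      TTilde.gen p (.star 0) * TTilde.gen p (.plain m) * TTilde.gen p (.star 0) *
        TTilde.gen p (.plain l) * TTilde.gen p (.star 0) := by
    have h1 := congrArg (fun x => TTilde.gen p (.star 0) * x * TTilde.gen p (.star 0))
      (TTilde.sum_plain_star_plain p l m 0 (by
        have := Fin.val_ne_of_ne hlm
        rw [lt_abs]; omega))
    have h2 := congrArg (fun x => TTilde.gen p (.star 0) * x * TTilde.gen p (.star 0))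
      (TTilde.sum_plain_star_plain p m l 0 (by
        have := Fin.val_ne_of_ne hlm
        rw [lt_abs]; omega))
    simp only [pow_zero, one_smul, Finset.mul_sum, Finset.sum_mul, mul_zero, zero_mul,
      ← mul_assoc] at h1 h2
    rw [Fin.sum_univ_succ] at h1 h2
    have h3 : ∀ i : Fin d, _ := fun i =>
      TTilde.word_symm_of_pos hp d le_rfl i.succ (by simp) l m
    simp only [h3] at h1
    exact add_right_cancel (h1.trans h2.symm)
  refine Subtype.ext ?_
  change TTilde.gen p (.star 0) * TTilde.gen p (.plain l) * TTilde.gen p (.star 0) *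
    (TTilde.gen p (.star 0) * TTilde.gen p (.plain m) * TTilde.gen p (.star 0)) =
    TTilde.gen p (.star 0) * TTilde.gen p (.plain m) * TTilde.gen p (.star 0) *
    (TTilde.gen p (.star 0) * TTilde.gen p (.plain l) * TTilde.gen p (.star 0))
  have hidem := (TTilde.isIdempotentElem_star_zero p).eq
  simp only [← mul_assoc]
  simp only [mul_assoc _ (TTilde.gen p (.star 0)) (TTilde.gen p (.star 0)), hidem]
  exact key

/-- The families of idempotents of `T̃` in the order in which they occur in a word that begins with
`ε*_0`, the starred ones being numbered backwards. -/
def TTilde.phase (p : Params d F) (n : ℕ) (i : Fin (d + 1)) : TTilde p :=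
  if Even n then TTilde.gen p (.plain i) else TTilde.gen p (.star i.rev)

theorem TTilde.isPhases (hp : p.Feasible) : IsPhases (TTilde.phase p)
    (fun n i => if Even n then p.th i else p.ths i.rev) where
  period n := by
    funext i
    simp [TTilde.phase, Nat.even_add]
  period_scalar n := by
    funext i
    simp [Nat.even_add]
  inj n := by
    by_cases h : Even n
    · simpa [h] using hp.th_inj
    · simpa [h, Function.comp_def] using hp.ths_inj.comp Fin.rev_injective
  orth n i j := by
    by_cases h : Even n
    · simp [TTilde.phase, h, TTilde.plain_mul_plain]
    · simp [TTilde.phase, h, TTilde.star_mul_star]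
  rel n i j k hk := by
    by_cases h : Even n
    · simp only [TTilde.phase, h, Nat.even_add_one, not_true_eq_false, if_true, if_false]
      have := TTilde.sum_plain_star_plain p i j k hk
      rwa [← Equiv.sum_comp Fin.revPerm] at this
    · simp only [TTilde.phase, h, Nat.even_add_one, not_false_eq_true, if_true, if_false]
      refine TTilde.sum_star_plain_star p i.rev j.rev k ?_
      have h1 := Fin.val_rev i
      have h2 := Fin.val_rev j
      rw [lt_abs] at hk ⊢
      omega

/-- A letter multiplied on the right either prolongs a product by the next phase, or belongs to the
family of the last letter and is absorbed or annihilates it. -/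
theorem TTilde.star_zero_mul_mem_head (x : TTilde p) :
    TTilde.gen p (.star 0) * x ∈ ⨆ n, head F (TTilde.phase p) (TTilde.gen p (.star 0)) n := by
  set e := TTilde.gen p (.star 0) with he
  set S := ⨆ n, head F (TTilde.phase p) e n with hS
  have hle : ∀ n, head F (TTilde.phase p) e n ≤ S := fun n => le_iSup _ n
  refine mul_mem_of_forall_gen S
    (hle 0 (Submodule.mem_span_singleton_self e)) (fun y hy h => ?_) x
  suffices hS' : S ≤ S.comap (LinearMap.mulRight F (TTilde.gen p h)) from hS' hy
  refine iSup_le fun n y hy => ?_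
  change y * TTilde.gen p h ∈ S
  have hstep : ∀ i, y * TTilde.phase p n i ∈ S := fun i => hle (n + 1) (mul_mem_head hy i)
  have hback : ∀ i, (∃ m, n = m + 1 ∧ TTilde.phase p m i = TTilde.gen p h) →
      y * TTilde.gen p h ∈ S := by
    rintro i ⟨m, rfl, hm⟩
    suffices hS' : head F (TTilde.phase p) e (m + 1) ≤
        S.comap (LinearMap.mulRight F (TTilde.gen p h)) from hS' hy
    refine iSup_le fun k => Submodule.map_le_iff_le_comap.mpr fun z hz => ?_
    change z * TTilde.phase p m k * TTilde.gen p h ∈ S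
    rw [mul_assoc, ← hm]
    by_cases heven : Even m
    · simp only [TTilde.phase, heven, if_true, TTilde.plain_mul_plain, mul_ite, mul_zero]
      split_ifs
      · have := hle _ (mul_mem_head hz k)
        simpa [TTilde.phase, heven] using this
      · exact S.zero_mem
    · simp only [TTilde.phase, heven, if_false, TTilde.star_mul_star, mul_ite, mul_zero]
      split_ifs
      · have := hle _ (mul_mem_head hz k)
        simpa [TTilde.phase, heven] using this
      · exact S.zero_mem
  cases h with
  | plain i =>
    by_cases heven : Even n
    · simpa [TTilde.phase, heven] using hstep i
    · obtain ⟨k, hk⟩ := Nat.not_even_iff_odd.mp heven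
      exact hback i ⟨2 * k, hk, by simp [TTilde.phase]⟩
  | star i =>
    by_cases heven : Even n
    · rcases n with _ | m
      · obtain ⟨c, rfl⟩ := Submodule.mem_span_singleton.mp hy
        rw [smul_mul_assoc, he, TTilde.star_mul_star]
        refine S.smul_mem c ?_
        split_ifs
        · exact hle 0 (Submodule.mem_span_singleton_self e)
        · exact S.zero_mem
      · have hm : ¬ Even m := by rwa [Nat.even_add_one] at heven
        exact hback i.rev ⟨m, rfl, by simp [TTilde.phase, hm]⟩
    · simpa [TTilde.phase, heven] using hstep i.rev

variable (p) in
/-- The inclusion of the corner `ε*_0 T̃ ε*_0` into `T̃`. -/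
def cornerVal : TTildeCorner p →ₗ[F] TTilde p where
  toFun x := x.1
  map_add' _ _ := rfl
  map_smul' _ _ := rfl

theorem cornerVal_injective : Function.Injective (cornerVal p) := fun _ _ h => Subtype.ext h

theorem adjoin_cornerGen (hp : p.Feasible) :
    Algebra.adjoin F (Set.range (cornerGen p)) = ⊤ := by
  set e := TTilde.gen p (.star 0) with he
  have hee : e * e = e := (TTilde.isIdempotentElem_star_zero p).eq
  set W : Submodule F (TTilde p) :=
    (Subalgebra.toSubmodule (Algebra.adjoin F (Set.range (cornerGen p)))).map (cornerVal p)
    with hW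
  have hmul : ∀ x ∈ W, ∀ y ∈ W, x * y ∈ W := by
    rintro _ ⟨x, hx, rfl⟩ _ ⟨y, hy, rfl⟩
    exact ⟨x * y, mul_mem (S := Subalgebra F (TTildeCorner p)) hx hy, rfl⟩
  have heW : e ∈ W := ⟨1, one_mem (Algebra.adjoin F (Set.range (cornerGen p))), rfl⟩
  have hgen : ∀ l, e * TTilde.phase p 0 l * e ∈ W := fun l =>
    ⟨cornerGen p l, Algebra.subset_adjoin ⟨l, rfl⟩, rfl⟩
  have hlast : e = TTilde.phase p 1 (Fin.last d) := by simp [TTilde.phase, he]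
  have hodd := head_mul_mem (TTilde.isPhases hp) hmul hlast hgen
  -- Odd lengths are `hodd`. A product of even length ends in a starred letter, which `e` absorbs or
  -- kills.
  have hall : ∀ n, head F (TTilde.phase p) e n ≤ W.comap (LinearMap.mulRight F e) := by
    intro n
    rcases Nat.even_or_odd' n with ⟨k, rfl | rfl⟩
    · rcases k with _ | k
      · rw [Nat.mul_zero, head, Submodule.span_singleton_le_iff_mem]
        change e * e ∈ W
        rwa [hee]
      · rw [show 2 * (k + 1) = 2 * k + 1 + 1 from rfl]
        refine iSup_le fun i => Submodule.map_le_iff_le_comap.mpr fun z hz => ?_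
        change z * TTilde.phase p (2 * k + 1) i * e ∈ W
        have hne : ¬ Even (2 * k + 1) := by simp
        simp only [TTilde.phase, hne, if_false, mul_assoc, he, TTilde.star_mul_star]
        split_ifs with h
        · rw [h]
          exact hodd k z hz
        · rw [mul_zero]
          exact W.zero_mem
    · exact fun y hy => hodd k y hy
  refine Algebra.eq_top_iff.mpr fun x => ?_
  have hx : e * x.1 * e ∈ W := (iSup_le hall) (TTilde.star_zero_mul_mem_head x.1)
  have hcorner := (Subsemigroup.mem_corner_iff (TTilde.isIdempotentElem_star_zero p)).mp x.2
  rw [hcorner.1, hcorner.2] at hx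
  obtain ⟨y, hy, hyx⟩ := hx
  rwa [← cornerVal_injective (a₁ := y) (a₂ := x) hyx]

/-- Evaluation takes place in the subalgebra generated by `c`, which is commutative even if `B` is
not. -/
theorem exists_algHom_of_commute {ι B : Type*} [Ring B] [Algebra F B] (c : ι → B)
    (hc : ∀ i j, c i * c j = c j * c i) :
    ∃ f : MvPolynomial ι F →ₐ[F] B,
      (∀ i, f (MvPolynomial.X i) = c i) ∧ f.range = Algebra.adjoin F (Set.range c) := by
  have hcomm := Algebra.isMulCommutative_adjoin F (s := Set.range c) (by
    rintro _ ⟨i, rfl⟩ _ ⟨j, rfl⟩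
    exact hc i j)
  let _ : CommRing (Algebra.adjoin F (Set.range c)) :=
    { (inferInstance : Ring (Algebra.adjoin F (Set.range c))) with
      mul_comm := hcomm.is_comm.comm }
  let f : MvPolynomial ι F →ₐ[F] Algebra.adjoin F (Set.range c) :=
    MvPolynomial.aeval fun i => ⟨c i, Algebra.subset_adjoin ⟨i, rfl⟩⟩
  have hX : ∀ i, (f (MvPolynomial.X i) : B) = c i := fun i => by simp [f]
  refine ⟨(Algebra.adjoin F (Set.range c)).val.comp f, hX, le_antisymm ?_ ?_⟩
  · rintro _ ⟨q, rfl⟩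
    exact (f q).2
  · refine Algebra.adjoin_le ?_
    rintro _ ⟨i, rfl⟩
    exact ⟨MvPolynomial.X i, hX i⟩

/-- The homomorphism from the polynomial algebra to `ε*_0 T̃ ε*_0`. -/
theorem exists_nu (hp : p.Feasible) :
    ∃ nu : MvPolynomial (Fin (d + 1)) F →ₐ[F] TTildeCorner p,
      (∀ i, nu (MvPolynomial.X i) = cornerGen p i) ∧ Function.Surjective nu := by
  obtain ⟨nu, hX, hrange⟩ := exists_algHom_of_commute (F := F) (cornerGen p) (cornerGen_comm hp)
  exact ⟨nu, hX, AlgHom.range_eq_top nu |>.mp (hrange.trans (adjoin_cornerGen hp))⟩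

end TTilde

/-! ### The word basis of Ť, its types and the relators. -/

section TCheck

variable {d : ℕ} {F : Type*} [Field F]

variable (F) in
/-- The product in `Ť` of a list of generators. -/
def wordProd (l : List (Gen d)) : TCheck d F := (l.map (TCheck.gen F)).prod

theorem wordProd_cons (g : Gen d) (l : List (Gen d)) :
    wordProd F (g :: l) = TCheck.gen F g * wordProd F l := by simp [wordProd]

theorem wordProd_append (l m : List (Gen d)) :
    wordProd F (l ++ m) = wordProd F l * wordProd F m := by simp [wordProd]

theorem wordProd_singleton (g : Gen d) : wordProd F [g] = TCheck.gen F g := by simp [wordProd]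

open Classical in
theorem TCheck.gen_mul_gen {g h : Gen d} (hgh : g.starred = h.starred) :
    TCheck.gen F g * TCheck.gen F h = if g = h then TCheck.gen F g else 0 := by
  cases g with
  | plain i =>
    cases h with
    | plain j =>
      have h := RingQuot.mkAlgHom_rel F (TCheckRel.plain (F := F) i j)
      rw [map_mul] at h
      refine h.trans ?_
      simp only [Gen.plain.injEq]
      split_ifs
      · rfl
      · exact map_zero _
    | star j => simp [Gen.starred] at hgh
  | star i =>
    cases h with
    | plain j => simp [Gen.starred] at hgh
    | star j =>
      have h := RingQuot.mkAlgHom_rel F (TCheckRel.star (F := F) i j)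
      rw [map_mul] at h
      refine h.trans ?_
      simp only [Gen.star.injEq]
      split_ifs
      · rfl
      · exact map_zero _

open Classical in
variable (F) in
/-- Left multiplication of a word by a generator. -/
def mulWord (g : Gen d) : List (Gen d) → (List (Gen d) →₀ F)
  | [] => Finsupp.single [g] 1
  | h :: l => if g.starred = h.starred then (if g = h then Finsupp.single (h :: l) 1 else 0)
      else Finsupp.single (g :: h :: l) 1

variable (F) in
/-- The action of a generator on the space of lists of generators. -/
def genAct (g : Gen d) : Module.End F (List (Gen d) →₀ F) :=
  Finsupp.linearCombination F (mulWord F g)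

theorem genAct_single (g : Gen d) (l : List (Gen d)) :
    genAct F g (Finsupp.single l 1) = mulWord F g l := by simp [genAct]

open Classical in
theorem genAct_mul_genAct {g h : Gen d} (hgh : g.starred = h.starred) :
    genAct F g * genAct F h = if g = h then genAct F g else 0 := by
  refine Finsupp.lhom_ext' fun l => LinearMap.ext_ring ?_
  simp only [LinearMap.comp_apply, Finsupp.lsingle_apply, Module.End.mul_apply, genAct_single]
  have happ : ∀ x, (if g = h then genAct F g else 0) (Finsupp.single x 1) =
      if g = h then mulWord F g x else 0 := fun x => by
    split_ifs
    · exact genAct_single g x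
    · rfl
  rw [happ]
  cases l with
  | nil =>
    simp only [mulWord, genAct_single, hgh, if_true]
    split_ifs with h1
    · rw [h1]
    · rfl
  | cons k l =>
    by_cases hk : h.starred = k.starred
    · simp only [mulWord, hk, hgh, if_true]
      by_cases h1 : h = k
      · subst h1
        simp only [if_true, genAct_single, mulWord, hgh]
        split_ifs <;> rfl
      · simp only [h1, if_false, map_zero]
        split_ifs with h2 h3
        · exact absurd (h2 ▸ h3) h1
        · rfl
        · rfl
    · simp only [mulWord, hk, hgh, if_false, genAct_single, if_true]
      split_ifs with h1
      · rw [h1]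
      · rfl

variable (d F) in
/-- The representation of `Ť` on the space of lists of generators. -/
def TCheck.rep : TCheck d F →ₐ[F] Module.End F (List (Gen d) →₀ F) :=
  RingQuot.liftAlgHom F ⟨FreeAlgebra.lift F (genAct F), by
    rintro _ _ (⟨i, j⟩ | ⟨i, j⟩)
    · rw [map_mul, FreeAlgebra.lift_ι_apply, FreeAlgebra.lift_ι_apply,
        genAct_mul_genAct (g := .plain i) (h := .plain j) rfl]
      simp only [Gen.plain.injEq]
      split_ifs
      · rw [FreeAlgebra.lift_ι_apply]
      · rw [map_zero]
    · rw [map_mul, FreeAlgebra.lift_ι_apply, FreeAlgebra.lift_ι_apply,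
        genAct_mul_genAct (g := .star i) (h := .star j) rfl]
      simp only [Gen.star.injEq]
      split_ifs
      · rw [FreeAlgebra.lift_ι_apply]
      · rw [map_zero]⟩

theorem TCheck.rep_gen (g : Gen d) : TCheck.rep d F (TCheck.gen F g) = genAct F g := by
  simp [TCheck.rep, TCheck.gen]

variable (d F) in
/-- The coordinates of an element of `Ť` with respect to the basis of words. -/
def TCheck.coord : TCheck d F →ₗ[F] (List (Gen d) →₀ F) :=
  (LinearMap.applyₗ (Finsupp.single [] 1)).comp (TCheck.rep d F).toLinearMap

theorem TCheck.coord_apply (x : TCheck d F) :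
    TCheck.coord d F x = TCheck.rep d F x (Finsupp.single [] 1) := rfl

/-- Van der Waerden's trick: acting on the empty list recovers the word, so distinct words are
linearly independent in Ť. -/
theorem TCheck.coord_wordProd {l : List (Gen d)} (hl : l.IsChain Gen.Alternating) :
    TCheck.coord d F (wordProd F l) = Finsupp.single l 1 := by
  induction l with
  | nil => simp [wordProd, TCheck.coord_apply]
  | cons g l ih =>
    have ih := ih hl.tail
    rw [TCheck.coord_apply] at ih ⊢
    rw [wordProd_cons, map_mul, Module.End.mul_apply, ih, TCheck.rep_gen, genAct_single]
    cases l with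
    | nil => rfl
    | cons h l =>
      have : g.starred ≠ h.starred := (List.isChain_cons_cons.mp hl).1
      simp [mulWord, this]

/-- The words of type `[n]`. -/
def IsBracket (n : ℕ) (l : List (Gen d)) : Prop :=
  l.length = 2 * n + 1 ∧ l.head? = some (.star 0) ∧ l.getLast? = some (.star 0)

theorem bracketList_isBracket (n : ℕ) : IsBracket n (bracketList d n) := by
  induction n with
  | zero => exact ⟨rfl, rfl, rfl⟩
  | succ n ih =>
    refine ⟨by simp [bracketList, ih.1]; omega, rfl, ?_⟩
    have hne : bracketList d n ≠ [] := by
      intro h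
      have := ih.1
      simp [h] at this
    rw [bracketList, List.getLast?_cons_cons, List.getLast?_cons_of_ne_nil hne, ih.2.2]

theorem type_eq_bracketType_iff {w : Word d} {n : ℕ} :
    w.type = bracketType d n ↔ IsBracket n w.1 := by
  have h := bracketList_isBracket (d := d) n
  refine Quotient.eq.trans ⟨fun hw => ⟨hw.1.trans h.1, hw.2.1.trans h.2.1, hw.2.2.trans h.2.2⟩,
    fun hw => ⟨hw.1.trans h.1.symm, hw.2.1.trans h.2.1.symm, hw.2.2.trans h.2.2.symm⟩⟩

open Classical in
variable (d F) in
/-- The projection of `Ť` onto `Ť_[n]`. -/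
def TCheck.bracketProj (n : ℕ) : TCheck d F →ₗ[F] TCheck d F :=
  (Finsupp.linearCombination F fun l => if IsBracket n l then wordProd F l else 0).comp
    (TCheck.coord d F)

open Classical in
theorem TCheck.bracketProj_wordProd (n : ℕ) {l : List (Gen d)}
    (hl : l.IsChain Gen.Alternating) : TCheck.bracketProj d F n (wordProd F l) =
      if IsBracket n l then wordProd F l else 0 := by
  simp [TCheck.bracketProj, TCheck.coord_wordProd hl]

theorem wordProd_mem_component {n : ℕ} {l : List (Gen d)} (hl : l.IsChain Gen.Alternating)
    (h : IsBracket n l) : wordProd F l ∈ TCheck.component F (bracketType d n) :=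
  Submodule.subset_span ⟨⟨l, hl⟩, type_eq_bracketType_iff.mpr h, rfl⟩

variable (p : Params d F)

/-- The convention at `k = 0` matches `c i ^ 0 = 1`, also when `c i = 0`, so one formula serves all
powers. -/
theorem sum_smul_pow {A ι : Type*} [Ring A] [Algebra F A] [Fintype ι] [DecidableEq ι]
    (x : ι → A) (hx : ∀ i j, x i * x j = if i = j then x i else 0) (c : ι → F) (k : ℕ) :
    (if k = 0 then ∑ i, x i else (∑ i, c i • x i) ^ k) = ∑ i, c i ^ k • x i := by
  rcases k with _ | k
  · simp
  · rw [if_neg (Nat.succ_ne_zero k)]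
    induction k with
    | zero => simp
    | succ k ih =>
      rw [pow_succ, ih, Finset.sum_mul]
      refine Finset.sum_congr rfl fun i _ => ?_
      rw [Finset.mul_sum, Finset.sum_eq_single i]
      · rw [smul_mul_smul_comm, hx, if_pos rfl, ← pow_succ]
      · intro j _ hj
        rw [smul_mul_smul_comm, hx, if_neg hj.symm, smul_zero]
      · simp

theorem TCheck.aPow_eq (k : ℕ) :
    TCheck.aPow p k = ∑ l, p.th l ^ k • TCheck.gen F (Gen.plain l) :=
  sum_smul_pow _ (fun i j => by
    rw [TCheck.gen_mul_gen (g := .plain i) (h := .plain j) rfl]; simp only [Gen.plain.injEq]) _ _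

theorem TCheck.aStarPow_eq (k : ℕ) :
    TCheck.aStarPow p k = ∑ l, p.ths l ^ k • TCheck.gen F (Gen.star l) :=
  sum_smul_pow _ (fun i j => by
    rw [TCheck.gen_mul_gen (g := .star i) (h := .star j) rfl]; simp only [Gen.star.injEq]) _ _

/-- A combination of words obtained by inserting generators between two fixed nontrivial words is
homogeneous. -/
theorem bracketProj_sum_insert {n : ℕ} {u v : List (Gen d)} (c : Fin (d + 1) → F)
    (x : Fin (d + 1) → Gen d) (hu : u ≠ []) (hv : v ≠ [])
    (hc : ∀ l, (u ++ x l :: v).IsChain Gen.Alternating) :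
    TCheck.bracketProj d F n (∑ l, c l • wordProd F (u ++ x l :: v)) = 0 ∨
      TCheck.bracketProj d F n (∑ l, c l • wordProd F (u ++ x l :: v)) =
          ∑ l, c l • wordProd F (u ++ x l :: v) ∧
        ∑ l, c l • wordProd F (u ++ x l :: v) ∈ TCheck.component F (bracketType d n) := by
  classical
  -- With `u` and `v` nonempty, the inserted letter is neither first nor last and does not affect
  -- the type.
  have hindep : ∀ l, IsBracket n (u ++ x l :: v) ↔ IsBracket n (u ++ x 0 :: v) := by
    intro l
    obtain ⟨a, u, rfl⟩ := List.exists_cons_of_ne_nil hu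
    obtain ⟨b, v, rfl⟩ := List.exists_cons_of_ne_nil hv
    have hlast : ∀ y, (a :: (u ++ y :: b :: v)).getLast? =
        (b :: v).getLast?.or (a :: u).getLast? := fun y => by
      rw [← List.cons_append, List.getLast?_append, List.getLast?_cons_cons]
    simp only [IsBracket, hlast, List.length_append, List.length_cons, List.cons_append,
      List.head?_cons]
  simp only [map_sum, map_smul, TCheck.bracketProj_wordProd n (hc _), hindep]
  by_cases h : IsBracket n (u ++ x 0 :: v)
  · refine Or.inr ⟨by simp [h], Submodule.sum_mem _ fun l _ => Submodule.smul_mem _ _ ?_⟩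
    exact wordProd_mem_component (hc l) ((hindep l).mpr h)
  · exact Or.inl (by simp [h])

theorem isChain_insert {u v : List (Gen d)} {g h x : Gen d} (hu : u.IsChain Gen.Alternating)
    (hv : v.IsChain Gen.Alternating) (hg : u.getLast? = some g) (hh : v.head? = some h)
    (h1 : g.Alternating x) (h2 : x.Alternating h) : (u ++ x :: v).IsChain Gen.Alternating := by
  refine List.isChain_append.mpr ⟨hu, ?_, ?_⟩
  · rw [List.isChain_cons]
    refine ⟨fun y hy => ?_, hv⟩
    rw [hh] at hy
    rwa [← Option.some_inj.mp hy]
  · intro y hy z hz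
    rw [hg] at hy
    rw [← Option.some_inj.mp hy, ← Option.some_inj.mp hz]
    exact h1

/-- Relators are homogeneous, so the projection keeps or kills each one. Hence the type [n] part of
any combination of relators lies in R_[n]. -/
theorem bracketProj_mem_relatorSpan (n : ℕ) {x : TCheck d F} (hx : IsRelator p x) :
    TCheck.bracketProj d F n x ∈ relatorSpan p (bracketType d n) := by
  suffices h : TCheck.bracketProj d F n x = 0 ∨ TCheck.bracketProj d F n x = x ∧
      x ∈ TCheck.component F (bracketType d n) by
    rcases h with h | ⟨h, hc⟩
    · rw [h]; exact Submodule.zero_mem _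
    · rw [h]; exact Submodule.subset_span ⟨hx, hc⟩
  cases hx with
  | plain u v k i j hu hv hk =>
    have : u.toTCheck F * TCheck.aStarPow p k * v.toTCheck F =
        ∑ l, p.ths l ^ k • wordProd F (u.1 ++ Gen.star l :: v.1) := by
      rw [TCheck.aStarPow_eq, Finset.mul_sum, Finset.sum_mul]
      refine Finset.sum_congr rfl fun l _ => ?_
      rw [wordProd_append, wordProd_cons, mul_smul_comm, smul_mul_assoc, mul_assoc]
      rfl
    rw [this]
    refine bracketProj_sum_insert _ _ (by rintro h; simp [h] at hu) (by rintro h; simp [h] at hv)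
      fun l => isChain_insert u.2 v.2 hu hv (by simp [Gen.Alternating, Gen.starred])
        (by simp [Gen.Alternating, Gen.starred])
  | star u v k i j hu hv hk =>
    have : u.toTCheck F * TCheck.aPow p k * v.toTCheck F =
        ∑ l, p.th l ^ k • wordProd F (u.1 ++ Gen.plain l :: v.1) := by
      rw [TCheck.aPow_eq, Finset.mul_sum, Finset.sum_mul]
      refine Finset.sum_congr rfl fun l _ => ?_
      rw [wordProd_append, wordProd_cons, mul_smul_comm, smul_mul_assoc, mul_assoc]
      rfl
    rw [this]
    refine bracketProj_sum_insert _ _ (by rintro h; simp [h] at hu) (by rintro h; simp [h] at hv)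
      fun l => isChain_insert u.2 v.2 hu hv (by simp [Gen.Alternating, Gen.starred])
        (by simp [Gen.Alternating, Gen.starred])

theorem gen_mul_word (g : Gen d) {u : Word d} (hu : u.1 ≠ []) :
    TCheck.gen F g * u.toTCheck F = 0 ∨
      ∃ w : Word d, TCheck.gen F g * u.toTCheck F = w.toTCheck F ∧
        w.1.getLast? = u.1.getLast? := by
  classical
  obtain ⟨l, hl⟩ := u
  obtain ⟨h, l, rfl⟩ := List.exists_cons_of_ne_nil hu
  by_cases hgh : g.starred = h.starred
  · have : TCheck.gen F g * Word.toTCheck F ⟨h :: l, hl⟩ =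
        (if g = h then TCheck.gen F g else 0) * wordProd F l := by
      rw [← TCheck.gen_mul_gen hgh, mul_assoc, ← wordProd_cons]
      rfl
    rw [this]
    split_ifs with h1
    · exact Or.inr ⟨⟨h :: l, hl⟩, by rw [h1, ← wordProd_cons]; rfl, rfl⟩
    · exact Or.inl (zero_mul _)
  · exact Or.inr ⟨⟨g :: h :: l, List.isChain_cons_cons.mpr ⟨hgh, hl⟩⟩, (wordProd_cons _ _).symm,
      List.getLast?_cons_cons⟩

theorem word_mul_gen (g : Gen d) {u : Word d} (hu : u.1 ≠ []) :
    u.toTCheck F * TCheck.gen F g = 0 ∨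
      ∃ w : Word d, u.toTCheck F * TCheck.gen F g = w.toTCheck F ∧ w.1.head? = u.1.head? := by
  classical
  obtain ⟨l, hl⟩ := u
  obtain ⟨l, h, rfl⟩ : ∃ l' h, l = l' ++ [h] := by
    simpa only [List.concat_eq_append] using (List.eq_nil_or_concat l).resolve_left hu
  by_cases hgh : h.starred = g.starred
  · have : Word.toTCheck F ⟨l ++ [h], hl⟩ * TCheck.gen F g =
        wordProd F l * (if h = g then TCheck.gen F h else 0) := by
      rw [← TCheck.gen_mul_gen hgh, ← mul_assoc, ← wordProd_singleton h, ← wordProd_append]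
      rfl
    rw [this]
    split_ifs with h1
    · exact Or.inr ⟨⟨l ++ [h], hl⟩, by rw [← wordProd_singleton, ← wordProd_append]; rfl, rfl⟩
    · exact Or.inl (mul_zero _)
  · refine Or.inr ⟨⟨(l ++ [h]) ++ [g], List.isChain_append.mpr ⟨hl, by simp, ?_⟩⟩, ?_, ?_⟩
    · simpa [Gen.Alternating] using hgh
    · rw [← wordProd_singleton g]
      exact (wordProd_append _ _).symm
    · simp [List.head?_append]

/-- The letter is absorbed at the outer end of `u`, whereas the relator condition sees only the
inner ends of `u` and `v`. With its mirror image, this makes the span of the relators an ideal. -/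
theorem gen_mul_mem_span_isRelator (g : Gen d) {x : TCheck d F} (hx : IsRelator p x) :
    TCheck.gen F g * x ∈ Submodule.span F {x | IsRelator p x} := by
  cases hx with
  | plain u v k i j hu hv hk =>
    rw [← mul_assoc, ← mul_assoc]
    rcases gen_mul_word (F := F) g (u := u) (by rintro h; simp [h] at hu) with h | ⟨w, h, hw⟩
    · simp [h]
    · rw [h]
      exact Submodule.subset_span (.plain w v k i j (hw.trans hu) hv hk)
  | star u v k i j hu hv hk =>
    rw [← mul_assoc, ← mul_assoc]
    rcases gen_mul_word (F := F) g (u := u) (by rintro h; simp [h] at hu) with h | ⟨w, h, hw⟩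
    · simp [h]
    · rw [h]
      exact Submodule.subset_span (.star w v k i j (hw.trans hu) hv hk)

theorem mul_gen_mem_span_isRelator (g : Gen d) {x : TCheck d F} (hx : IsRelator p x) :
    x * TCheck.gen F g ∈ Submodule.span F {x | IsRelator p x} := by
  cases hx with
  | plain u v k i j hu hv hk =>
    rw [mul_assoc]
    rcases word_mul_gen (F := F) g (u := v) (by rintro h; simp [h] at hv) with h | ⟨w, h, hw⟩
    · simp [h]
    · rw [h]
      exact Submodule.subset_span (.plain u w k i j hu (hw.trans hv) hk)
  | star u v k i j hu hv hk =>
    rw [mul_assoc]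
    rcases word_mul_gen (F := F) g (u := v) (by rintro h; simp [h] at hv) with h | ⟨w, h, hw⟩
    · simp [h]
    · rw [h]
      exact Submodule.subset_span (.star u w k i j hu (hw.trans hv) hk)

end TCheck

/-! ### Zigzag words of type [n] are weakly decreasing sequences of indices. -/

section Zigzag

variable {d : ℕ}

/-- The word `ε*_0 ε_{i_1} ε*_0 ε_{i_2} ⋯ ε*_0`. -/
def interleave : List (Fin (d + 1)) → List (Gen d)
  | [] => [.star 0]
  | i :: L => .star 0 :: .plain i :: interleave L

theorem length_interleave (L : List (Fin (d + 1))) :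
    (interleave L).length = 2 * L.length + 1 := by
  induction L with
  | nil => rfl
  | cons i L ih => simp [interleave, ih]; omega

theorem head?_interleave (L : List (Fin (d + 1))) : (interleave L).head? = some (.star 0) := by
  cases L <;> rfl

theorem getLast?_interleave (L : List (Fin (d + 1))) :
    (interleave L).getLast? = some (.star 0) := by
  induction L with
  | nil => rfl
  | cons i L ih =>
    have hne : interleave L ≠ [] := by cases L <;> simp [interleave]
    rw [interleave, List.getLast?_cons_cons, List.getLast?_cons_of_ne_nil hne, ih]

theorem isBracket_interleave {n : ℕ} (L : List (Fin (d + 1))) :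
    IsBracket n (interleave L) ↔ L.length = n := by
  rw [IsBracket, length_interleave]
  simp [head?_interleave, getLast?_interleave]

theorem isChain_interleave (L : List (Fin (d + 1))) :
    (interleave L).IsChain Gen.Alternating := by
  induction L with
  | nil => simp [interleave]
  | cons i L ih =>
    rw [interleave, List.isChain_cons_cons, List.isChain_cons]
    refine ⟨by simp [Gen.Alternating, Gen.starred], fun y hy => ?_, ih⟩
    rw [head?_interleave] at hy
    rw [← Option.some_inj.mp hy]
    simp [Gen.Alternating, Gen.starred]

theorem interleave_injective : Function.Injective (interleave (d := d)) := by
  intro L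
  induction L with
  | nil => intro M h; cases M with
    | nil => rfl
    | cons => simp [interleave] at h
  | cons i L ih => intro M h; cases M with
    | nil => simp [interleave] at h
    | cons j M =>
      simp only [interleave, List.cons.injEq, Gen.plain.injEq, true_and] at h
      rw [h.1, ih h.2]

theorem getElem_interleave_even (L : List (Fin (d + 1))) (k : ℕ)
    (h : 2 * k < (interleave L).length) : (interleave L)[2 * k] = .star 0 := by
  induction L generalizing k with
  | nil => simp [interleave]
  | cons i L ih =>
    rcases k with _ | k
    · rfl
    · exact ih k (by simp [interleave] at h; omega)

theorem getElem_interleave_odd (L : List (Fin (d + 1))) (k : ℕ) (hk : k < L.length)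
    (h : 2 * k + 1 < (interleave L).length) : (interleave L)[2 * k + 1] = .plain L[k] := by
  induction L generalizing k with
  | nil => simp at hk
  | cons i L ih =>
    rcases k with _ | k
    · rfl
    · exact ih k (by simpa using hk) (by simp [interleave] at h; omega)

theorem isZigzag_interleave {L : List (Fin (d + 1))} (hL : L.IsChain (· ≥ ·)) :
    Word.IsZigzag ⟨interleave L, isChain_interleave L⟩ := by
  have hlen := length_interleave L
  have hmono : ∀ k (h : k + 1 < L.length), L[k + 1] ≤ L[k] := fun k h =>
    List.isChain_iff_getElem.mp hL k h
  constructor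
  · intro m hm
    change m + 2 < (interleave L).length at hm
    change ¬ Between (interleave L)[m].index (interleave L)[m + 2].index
      (interleave L)[m + 1].index
    rcases Nat.even_or_odd' m with ⟨k, rfl | rfl⟩
    · have e1 := getElem_interleave_even L k (by omega)
      have e2 := getElem_interleave_even L (k + 1) (by omega)
      simp only [e1, show 2 * k + 2 = 2 * (k + 1) by ring, e2, Between, Gen.index]
      omega
    · have e1 := getElem_interleave_odd L k (by omega) (by omega)
      have e2 := getElem_interleave_even L (k + 1) (by omega)
      have e3 := getElem_interleave_odd L (k + 1) (by omega) (by omega)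
      have := hmono k (by omega)
      rw [Fin.le_def] at this
      simp only [e1, show 2 * k + 1 + 2 = 2 * (k + 1) + 1 by ring, e3,
        show 2 * k + 1 + 1 = 2 * (k + 1) by ring, e2, Between, Gen.index, Fin.val_zero]
      omega
  · intro m hm
    change m + 3 < (interleave L).length at hm
    change ¬ Between (interleave L)[m].index (interleave L)[m + 3].index
      (interleave L)[m + 1].index ∨ ¬ Between (interleave L)[m].index (interleave L)[m + 3].index
      (interleave L)[m + 2].index
    rcases Nat.even_or_odd' m with ⟨k, rfl | rfl⟩
    · left
      have e1 := getElem_interleave_even L k (by omega)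
      have e2 := getElem_interleave_odd L k (by omega) (by omega)
      have e3 := getElem_interleave_odd L (k + 1) (by omega) (by omega)
      have := hmono k (by omega)
      rw [Fin.le_def] at this
      simp only [e1, show 2 * k + 3 = 2 * (k + 1) + 1 by ring, e2, e3, Between, Gen.index,
        Fin.val_zero]
      omega
    · left
      have e1 := getElem_interleave_odd L k (by omega) (by omega)
      have e2 := getElem_interleave_even L (k + 1) (by omega)
      have e3 := getElem_interleave_even L (k + 2) (by omega)
      simp only [e1, show 2 * k + 1 + 3 = 2 * (k + 2) by ring, e3,
        show 2 * k + 1 + 1 = 2 * (k + 1) by ring, e2, Between, Gen.index, Fin.val_zero]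
      omega

/-- The index sequence of a zigzag word that begins with index `0` is contracting. -/
theorem contracting_of_zigzag {c : ℕ → ℕ} {N : ℕ} (h0 : c 0 = 0)
    (h1 : ∀ m, m + 2 < N → ¬ Between (c m) (c (m + 2)) (c (m + 1)))
    (h2 : ∀ m, m + 3 < N → ¬ Between (c m) (c (m + 3)) (c (m + 1)) ∨
      ¬ Between (c m) (c (m + 3)) (c (m + 2))) (m : ℕ) (hm : m + 2 < N) :
    (Even m → c m ≤ c (m + 2) ∧ c (m + 2) ≤ c (m + 1)) ∧
      (Odd m → c (m + 1) ≤ c (m + 2) ∧ c (m + 2) ≤ c m) := by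
  induction m with
  | zero =>
    have := h1 0 hm
    simp only [Between, h0, zero_add] at this ⊢
    refine ⟨fun _ => ?_, fun h => by simp at h⟩
    omega
  | succ m ih =>
    have ih := ih (by omega)
    have a := h1 (m + 1) hm
    have b := h2 m (by omega)
    simp only [Between, show m + 1 + 2 = m + 3 from rfl, show m + 1 + 1 = m + 2 from rfl] at *
    refine ⟨fun h => ?_, fun h => ?_⟩
    · have := ih.2 (Nat.not_even_iff_odd.mp (Nat.even_add_one.mp h))
      omega
    · have := ih.1 (by rwa [Nat.odd_add_one, Nat.not_odd_iff_even] at h)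
      omega

theorem exists_eq_interleave (n : ℕ) : ∀ {l : List (Gen d)}, l.IsChain Gen.Alternating →
    l.length = 2 * n + 1 → l.head? = some (.star 0) →
    (∀ k (h : 2 * k < l.length), l[2 * k].index = 0) →
    (∀ k (h : 2 * k + 3 < l.length), l[2 * k + 3].index ≤ l[2 * k + 1].index) →
    ∃ L : List (Fin (d + 1)), L.IsChain (· ≥ ·) ∧ l = interleave L := by
  induction n with
  | zero =>
    intro l _ hlen hhead _ _
    obtain ⟨a, rfl⟩ := List.length_eq_one_iff.mp hlen
    exact ⟨[], by simp, by simpa [interleave] using hhead⟩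
  | succ n ih =>
    intro l hc hlen hhead heven hodd
    match l, hlen with
    | a :: b :: e :: l, hlen =>
      obtain ⟨hab, hbc⟩ := List.isChain_cons_cons.mp hc
      obtain ⟨hbe, hec⟩ := List.isChain_cons_cons.mp hbc
      have ha : a = .star 0 := by simpa using hhead
      subst ha
      have hb : ∃ i, b = .plain i := by
        cases b with
        | plain i => exact ⟨i, rfl⟩
        | star i => simp [Gen.Alternating, Gen.starred] at hab
      obtain ⟨i, rfl⟩ := hb
      have he : e = .star 0 := by
        have h := heven 1 (by simp)
        cases e with
        | plain j => simp [Gen.Alternating, Gen.starred] at hbe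
        | star j =>
          have hj : (j : ℕ) = 0 := h
          rw [show j = 0 from Fin.ext hj]
      subst he
      obtain ⟨L, hL, hl⟩ := ih hec
        (by simp only [List.length_cons] at hlen ⊢; omega) rfl
        (fun k h => heven (k + 1) (by simp only [List.length_cons] at h ⊢; omega))
        (fun k h => hodd (k + 1) (by simp only [List.length_cons] at h ⊢; omega))
      refine ⟨i :: L, ?_, by rw [hl]; rfl⟩
      cases L with
      | nil => simp
      | cons j L =>
        refine List.isChain_cons_cons.mpr ⟨?_, hL⟩
        simp only [interleave, List.cons.injEq, true_and] at hl
        subst hl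
        exact hodd 0 (by simp)

/-- By contraction the indices at even positions weakly increase from 0 and those at odd positions
weakly decrease. The last even position also carries 0, so all starred letters are ε*_0. -/
theorem Word.IsZigzag.exists_eq_interleave {n : ℕ} {w : Word d} (hw : w.IsZigzag)
    (hn : IsBracket n w.1) :
    ∃ L : List (Fin (d + 1)), L.IsChain (· ≥ ·) ∧ w.1 = interleave L := by
  obtain ⟨l, hl⟩ := w
  obtain ⟨hlen, hhead, hlast⟩ := hn
  change l.length = 2 * n + 1 at hlen
  change l.head? = some (.star 0) at hhead
  change l.getLast? = some (.star 0) at hlast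
  let c : ℕ → ℕ := fun m => if h : m < l.length then l[m].index else 0
  have hcv : ∀ m (h : m < l.length), c m = l[m].index := fun m h => dif_pos h
  have h0 : c 0 = 0 := by
    rw [hcv 0 (by omega)]
    rw [List.head?_eq_getElem?, List.getElem?_eq_getElem (by omega), Option.some_inj] at hhead
    simp [hhead, Gen.index]
  have hend : c (2 * n) = 0 := by
    rw [hcv _ (by omega)]
    rw [List.getLast?_eq_getElem?, List.getElem?_eq_getElem (by omega), Option.some_inj] at hlast
    simp only [hlen, Nat.add_sub_cancel] at hlast
    simp [hlast, Gen.index]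
  have hcon := contracting_of_zigzag (c := c) (N := l.length) h0
    (fun m hm => by
      rw [hcv m (by omega), hcv (m + 1) (by omega), hcv (m + 2) hm]; exact hw.1 m hm)
    (fun m hm => by
      rw [hcv m (by omega), hcv (m + 1) (by omega), hcv (m + 2) (by omega), hcv (m + 3) hm]
      exact hw.2 m hm)
  have heven : ∀ k, k ≤ n → c (2 * (n - k)) = 0 := by
    intro k
    induction k with
    | zero => exact fun _ => hend
    | succ k ih =>
      intro hk
      have h := (hcon (2 * (n - (k + 1))) (by omega)).1 (by simp)
      rw [show 2 * (n - (k + 1)) + 2 = 2 * (n - k) by omega, ih (by omega)] at h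
      omega
  refine SharpTD.exists_eq_interleave n hl hlen hhead (fun k h => ?_) (fun k h => ?_)
  · rw [← hcv]
    change 2 * k < l.length at h
    have := heven (n - k) (by omega)
    rwa [show n - (n - k) = k by omega] at this
  · rw [← hcv, ← hcv]
    exact ((hcon (2 * k + 1) (by omega)).2 (by simp)).2

end Zigzag

/-! ### T̃ as a quotient of Ť, and the comparison of polynomials with zigzag words. -/

section Main

variable {d : ℕ} {F : Type*} [Field F] (p : Params d F)

/-- The canonical homomorphism from `Ť` to `T̃`. -/
def toTTilde : TCheck d F →ₐ[F] TTilde p :=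
  RingQuot.liftAlgHom F ⟨FreeAlgebra.lift F (TTilde.gen p), by
    rintro _ _ (⟨i, j⟩ | ⟨i, j⟩)
    · rw [map_mul, FreeAlgebra.lift_ι_apply, FreeAlgebra.lift_ι_apply, TTilde.plain_mul_plain]
      split_ifs
      · rw [FreeAlgebra.lift_ι_apply]
      · rw [map_zero]
    · rw [map_mul, FreeAlgebra.lift_ι_apply, FreeAlgebra.lift_ι_apply, TTilde.star_mul_star]
      split_ifs
      · rw [FreeAlgebra.lift_ι_apply]
      · rw [map_zero]⟩

theorem toTTilde_gen (g : Gen d) : toTTilde p (TCheck.gen F g) = TTilde.gen p g := by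
  simp [toTTilde, TCheck.gen]

theorem toTTilde_comp_mk : (toTTilde p).comp (RingQuot.mkAlgHom F (TCheckRel d F)) =
    RingQuot.mkAlgHom F (TTildeRel p) := by
  ext g
  exact toTTilde_gen p g

theorem toTTilde_relator {x : TCheck d F} (hx : IsRelator p x) : toTTilde p x = 0 := by
  cases hx with
  | plain u v k i j hu hv hk =>
    obtain ⟨u', hu'⟩ := List.getLast?_eq_some_iff.mp hu
    obtain ⟨v', hv'⟩ := List.head?_eq_some_iff.mp hv
    have h : u.toTCheck F * TCheck.aStarPow p k * v.toTCheck F =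
        wordProd F u' * (∑ l, p.ths l ^ k • (TCheck.gen F (.plain i) * TCheck.gen F (.star l) *
          TCheck.gen F (.plain j))) * wordProd F v' := by
      rw [Word.toTCheck, Word.toTCheck, hu', hv', ← wordProd, ← wordProd, wordProd_append,
        wordProd_singleton, wordProd_cons, TCheck.aStarPow_eq]
      simp only [Finset.sum_mul, Finset.mul_sum, smul_mul_assoc, mul_smul_comm, mul_assoc]
    rw [h, map_mul, map_mul, map_sum]
    simp only [map_smul, map_mul, toTTilde_gen, TTilde.sum_plain_star_plain p i j k hk, mul_zero,
      zero_mul]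
  | star u v k i j hu hv hk =>
    obtain ⟨u', hu'⟩ := List.getLast?_eq_some_iff.mp hu
    obtain ⟨v', hv'⟩ := List.head?_eq_some_iff.mp hv
    have h : u.toTCheck F * TCheck.aPow p k * v.toTCheck F =
        wordProd F u' * (∑ l, p.th l ^ k • (TCheck.gen F (.star i) * TCheck.gen F (.plain l) *
          TCheck.gen F (.star j))) * wordProd F v' := by
      rw [Word.toTCheck, Word.toTCheck, hu', hv', ← wordProd, ← wordProd, wordProd_append,
        wordProd_singleton, wordProd_cons, TCheck.aPow_eq]
      simp only [Finset.sum_mul, Finset.mul_sum, smul_mul_assoc, mul_smul_comm, mul_assoc]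
    rw [h, map_mul, map_mul, map_sum]
    simp only [map_smul, map_mul, toTTilde_gen, TTilde.sum_star_plain_star p i j k hk, mul_zero,
      zero_mul]

/-- The two-sided ideal of `Ť` spanned by the relators. -/
def relatorIdeal : TwoSidedIdeal (TCheck d F) :=
  .mk' (Submodule.span F {x : TCheck d F | IsRelator p x}) (Submodule.zero_mem _)
    (Submodule.add_mem _) (Submodule.neg_mem _)
    (fun {x _} hy => mul_mem_of_forall_gen_left _ hy (fun _ hz h =>
      (Submodule.span_le (p := (Submodule.span F {x : TCheck d F | IsRelator p x}).comap
        (LinearMap.mulLeft F (TCheck.gen F h)))).mpr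
        (fun _ => gen_mul_mem_span_isRelator p h) hz) x)
    (fun {_ y} hx => mul_mem_of_forall_gen _ hx (fun _ hz h =>
      (Submodule.span_le (p := (Submodule.span F {x : TCheck d F | IsRelator p x}).comap
        (LinearMap.mulRight F (TCheck.gen F h)))).mpr
        (fun _ => mul_gen_mem_span_isRelator p h) hz) y)

theorem mem_relatorIdeal {x : TCheck d F} :
    x ∈ relatorIdeal p ↔ x ∈ Submodule.span F {x : TCheck d F | IsRelator p x} :=
  TwoSidedIdeal.mem_mk' _ _ _ _ _ _ _

theorem mkₐ_relatorIdeal_eq_zero_iff {x : TCheck d F} :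
    (relatorIdeal p).ringCon.mkₐ (α := F) x = 0 ↔
      x ∈ Submodule.span F {x : TCheck d F | IsRelator p x} := by
  rw [← mem_relatorIdeal, TwoSidedIdeal.mem_iff]
  exact RingCon.eq _

/-- Ť modulo the relators satisfies the relations of T̃, so its quotient map factors through
`toTTilde`. With `toTTilde_relator` this determines the kernel of `toTTilde`. -/
theorem mem_span_isRelator_of_toTTilde_eq_zero {x : TCheck d F} (hx : toTTilde p x = 0) :
    x ∈ Submodule.span F {x : TCheck d F | IsRelator p x} := by
  set q := (relatorIdeal p).ringCon.mkₐ (α := F) with hq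
  have hrel : ∀ ⦃a b : FreeAlgebra F (Gen d)⦄, TTildeRel p a b →
      q.comp (RingQuot.mkAlgHom F (TCheckRel d F)) a =
        q.comp (RingQuot.mkAlgHom F (TCheckRel d F)) b := by
    rintro _ _ (⟨i, j⟩ | ⟨i, j⟩ | ⟨i, j, k, hk⟩ | ⟨i, j, k, hk⟩)
    · exact congrArg q (RingQuot.mkAlgHom_rel F (TCheckRel.plain i j))
    · exact congrArg q (RingQuot.mkAlgHom_rel F (TCheckRel.star i j))
    · rw [map_zero, eq_comm, AlgHom.comp_apply, hq, mkₐ_relatorIdeal_eq_zero_iff]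
      refine Submodule.subset_span ?_
      -- A defining relation of T̃ is a relator whose two outer words are single letters.
      have := IsRelator.star (p := p) ⟨[.star i], by simp⟩ ⟨[.star j], by simp⟩ k i j rfl rfl hk
      convert this using 1
      rw [TCheck.aPow_eq, Finset.mul_sum, Finset.sum_mul]
      simp [Word.toTCheck, TCheck.gen]
    · rw [map_zero, eq_comm, AlgHom.comp_apply, hq, mkₐ_relatorIdeal_eq_zero_iff]
      refine Submodule.subset_span ?_
      have := IsRelator.plain (p := p) ⟨[.plain i], by simp⟩ ⟨[.plain j], by simp⟩ k i j rfl rfl hk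
      convert this using 1
      rw [TCheck.aStarPow_eq, Finset.mul_sum, Finset.sum_mul]
      simp [Word.toTCheck, TCheck.gen]
  have hcomp : (RingQuot.liftAlgHom F ⟨_, hrel⟩).comp (toTTilde p) = q := by
    refine RingQuot.ringQuot_ext' F _ _ ?_
    rw [AlgHom.comp_assoc, toTTilde_comp_mk]
    ext g
    simp
  rw [← mkₐ_relatorIdeal_eq_zero_iff, ← hq, ← hcomp, AlgHom.comp_apply, hx, map_zero]

variable (d F) in
/-- The linear map from the polynomial algebra to `Ť` that sends a monomial to the word
`ε*_0 ε_{i_1} ε*_0 ⋯ ε*_0` with `i_1 ≥ i_2 ≥ ⋯`. -/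
def polyLift : MvPolynomial (Fin (d + 1)) F →ₗ[F] TCheck d F :=
  (MvPolynomial.basisMonomials (Fin (d + 1)) F).constr F fun s =>
    wordProd F (interleave ((Finsupp.toMultiset s).sort (· ≥ ·)))

theorem polyLift_monomial (s : Fin (d + 1) →₀ ℕ) : polyLift d F (MvPolynomial.monomial s 1) =
    wordProd F (interleave ((Finsupp.toMultiset s).sort (· ≥ ·))) := by
  have h := congrFun (MvPolynomial.coe_basisMonomials (Fin (d + 1)) F) s
  rw [polyLift, ← h, Module.Basis.constr_basis]

/-- Each coefficient of a polynomial is read off as the coordinate of its image at the corresponding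
word. -/
theorem polyLift_injective : Function.Injective (polyLift d F) := by
  classical
  have key : ∀ s, (Finsupp.lapply (interleave ((Finsupp.toMultiset s).sort (· ≥ ·)))).comp
      ((TCheck.coord d F).comp (polyLift d F)) = MvPolynomial.lcoeff F s := by
    intro s
    refine (MvPolynomial.basisMonomials _ F).ext fun t => ?_
    rw [MvPolynomial.coe_basisMonomials]
    simp only [LinearMap.comp_apply, polyLift_monomial,
      TCheck.coord_wordProd (isChain_interleave _), Finsupp.lapply_apply, MvPolynomial.lcoeff_apply,
      MvPolynomial.coeff_monomial, Finsupp.single_apply]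
    refine if_congr ⟨fun h => ?_, fun h => by rw [h]⟩ rfl rfl
    have := congrArg (fun l : List (Fin (d + 1)) => (l : Multiset (Fin (d + 1)))) (interleave_injective h)
    simp only [Multiset.sort_eq] at this
    exact Multiset.toFinsupp.symm.injective this
  refine (injective_iff_map_eq_zero _).mpr fun f hf => MvPolynomial.ext _ _ fun s => ?_
  have := LinearMap.congr_fun (key s) f
  simp only [LinearMap.comp_apply, hf, map_zero] at this
  exact this.symm

theorem polyLift_homogeneousComponent (n : ℕ) (f : MvPolynomial (Fin (d + 1)) F) :
    polyLift d F (MvPolynomial.homogeneousComponent n f) =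
      TCheck.bracketProj d F n (polyLift d F f) := by
  classical
  suffices h : (polyLift d F).comp (MvPolynomial.homogeneousComponent n) =
      (TCheck.bracketProj d F n).comp (polyLift d F) from LinearMap.congr_fun h f
  refine (MvPolynomial.basisMonomials _ F).ext fun s => ?_
  rw [MvPolynomial.coe_basisMonomials]
  simp only [LinearMap.comp_apply, polyLift_monomial,
    TCheck.bracketProj_wordProd n (isChain_interleave _), isBracket_interleave,
    Multiset.length_sort]
  rw [MvPolynomial.homogeneousComponent_of_mem (MvPolynomial.isHomogeneous_monomial 1 rfl),
    Finsupp.card_toMultiset]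
  have : s.degree = s.sum fun _ => id := rfl
  rw [this]
  by_cases h : n = s.sum fun _ => id
  · rw [if_pos h, if_pos h.symm, polyLift_monomial]
  · rw [if_neg h, if_neg (Ne.symm h), map_zero]

theorem polyLift_homogeneousComponent_mem (n : ℕ) (f : MvPolynomial (Fin (d + 1)) F) :
    polyLift d F (MvPolynomial.homogeneousComponent n f) ∈ zigzagSpan F (bracketType d n) := by
  classical
  suffices h : ⊤ ≤ (zigzagSpan F (bracketType d n)).comap
      ((polyLift d F).comp (MvPolynomial.homogeneousComponent n)) from h trivial
  rw [← (MvPolynomial.basisMonomials _ F).span_eq, Submodule.span_le]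
  rintro _ ⟨s, rfl⟩
  rw [MvPolynomial.coe_basisMonomials]
  change polyLift d F (MvPolynomial.homogeneousComponent n (MvPolynomial.monomial s 1)) ∈
    zigzagSpan F (bracketType d n)
  rw [polyLift_homogeneousComponent, polyLift_monomial,
    TCheck.bracketProj_wordProd n (isChain_interleave _)]
  split_ifs with h
  · refine Submodule.subset_span ⟨⟨_, isChain_interleave _⟩, isZigzag_interleave ?_,
      type_eq_bracketType_iff.mpr h, rfl⟩
    exact List.isChain_iff_pairwise.mpr (Multiset.pairwise_sort _ _)
  · exact Submodule.zero_mem _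

/-- A weakly decreasing list is the sorted form of its multiset, hence comes from a monomial. -/
theorem zigzagSpan_le_range_polyLift (n : ℕ) :
    zigzagSpan F (bracketType d n) ≤ LinearMap.range (polyLift d F) := by
  refine Submodule.span_le.mpr ?_
  rintro _ ⟨w, hw, hn, rfl⟩
  obtain ⟨L, hL, hwL⟩ := hw.exists_eq_interleave (type_eq_bracketType_iff.mp hn)
  refine ⟨MvPolynomial.monomial (Multiset.toFinsupp (L : Multiset (Fin (d + 1)))) 1, ?_⟩
  rw [polyLift_monomial, Multiset.toFinsupp_toMultiset]
  have : (L : Multiset (Fin (d + 1))).sort (· ≥ ·) = L :=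
    List.Perm.eq_of_pairwise' (r := (· ≥ ·)) (Multiset.pairwise_sort _ _)
      (List.isChain_iff_pairwise.mp hL) (Multiset.coe_eq_coe.mp (Multiset.sort_eq _ _))
  rw [this, ← hwL]
  rfl

variable {p}

theorem toTTilde_wordProd_interleave (L : List (Fin (d + 1))) :
    toTTilde p (wordProd F (interleave L)) = cornerVal p (L.map (cornerGen p)).prod := by
  have hidem := (TTilde.isIdempotentElem_star_zero p).eq
  induction L with
  | nil =>
    rw [interleave, wordProd_singleton, toTTilde_gen]
    rfl
  | cons i L ih =>
    rw [interleave, wordProd_cons, wordProd_cons, map_mul, map_mul, ih, toTTilde_gen, toTTilde_gen,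
      List.map_cons, List.prod_cons]
    set x := (L.map (cornerGen p)).prod
    have hx := (Subsemigroup.mem_corner_iff (TTilde.isIdempotentElem_star_zero p)).mp x.2
    change _ = TTilde.gen p (.star 0) * TTilde.gen p (.plain i) * TTilde.gen p (.star 0) * x.1
    rw [mul_assoc _ _ x.1, hx.1, mul_assoc]
    rfl

theorem toTTilde_polyLift {nu : MvPolynomial (Fin (d + 1)) F →ₐ[F] TTildeCorner p}
    (hnu : ∀ i, nu (MvPolynomial.X i) = cornerGen p i) (f : MvPolynomial (Fin (d + 1)) F) :
    toTTilde p (polyLift d F f) = cornerVal p (nu f) := by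
  suffices h : (toTTilde p).toLinearMap.comp (polyLift d F) =
      (cornerVal p).comp nu.toLinearMap from LinearMap.congr_fun h f
  refine (MvPolynomial.basisMonomials _ F).ext fun s => ?_
  rw [MvPolynomial.coe_basisMonomials]
  simp only [LinearMap.comp_apply, polyLift_monomial, AlgHom.toLinearMap_apply,
    toTTilde_wordProd_interleave]
  congr 1
  set L := (Finsupp.toMultiset s).sort (· ≥ ·) with hL
  have hs : MvPolynomial.monomial s (1 : F) = (L.map MvPolynomial.X).prod := by
    rw [← Multiset.prod_coe, ← Multiset.map_coe, hL, Multiset.sort_eq, Finsupp.toMultiset_map,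
      Finsupp.prod_toMultiset, Finsupp.prod_mapDomain_index (by simp) (fun _ _ _ => pow_add _ _ _),
      MvPolynomial.monomial_eq, map_one, one_mul]
  rw [hs, map_list_prod, List.map_map]
  congr 2
  funext i
  exact (hnu i).symm

/-- Through `polyLift`, an element of R_[n] ∩ Z_[n] is a polynomial killed by ν. Conversely, if ν
kills `f`, the image of `f` is a combination of relators, and projecting to type [n] puts each
homogeneous component of `f` in R_[n] ∩ Z_[n]. -/
theorem injective_iff_isDirect {nu : MvPolynomial (Fin (d + 1)) F →ₐ[F] TTildeCorner p}
    (hnu : ∀ i, nu (MvPolynomial.X i) = cornerGen p i) :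
    Function.Injective nu ↔ ∀ n, IsDirect p (bracketType d n) := by
  constructor
  · intro hinj n
    refine Submodule.disjoint_def.mpr fun x hxR hxZ => ?_
    obtain ⟨f, rfl⟩ := zigzagSpan_le_range_polyLift n hxZ
    have h0 : relatorSpan p (bracketType d n) ≤ LinearMap.ker (toTTilde p).toLinearMap :=
      Submodule.span_le.mpr fun y hy => toTTilde_relator p hy.1
    have h1 : toTTilde p (polyLift d F f) = 0 := h0 hxR
    rw [toTTilde_polyLift hnu] at h1
    have h2 : nu f = 0 := cornerVal_injective (h1.trans (map_zero _).symm)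
    rw [hinj (h2.trans (map_zero nu).symm), map_zero]
  · intro hdir
    refine (injective_iff_map_eq_zero nu).mpr fun f hf => ?_
    have h1 : toTTilde p (polyLift d F f) = 0 := by rw [toTTilde_polyLift hnu, hf, map_zero]
    have h2 := mem_span_isRelator_of_toTTilde_eq_zero p h1
    have h3 : ∀ n, MvPolynomial.homogeneousComponent n f = 0 := by
      intro n
      have hR : polyLift d F (MvPolynomial.homogeneousComponent n f) ∈
          relatorSpan p (bracketType d n) := by
        rw [polyLift_homogeneousComponent]
        exact (Submodule.span_le (p := (relatorSpan p (bracketType d n)).comap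
          (TCheck.bracketProj d F n))).mpr (fun _ hx => bracketProj_mem_relatorSpan p n hx) h2
      exact polyLift_injective ((Submodule.disjoint_def.mp (hdir n) _ hR
        (polyLift_homogeneousComponent_mem n f)).trans (map_zero _).symm)
    rw [← MvPolynomial.sum_homogeneousComponent f]
    exact Finset.sum_eq_zero fun n _ => h3 n

end Main

end SharpTD

end

theorem mainTheorem9 {F : Type*} [Field F] (d : ℕ) (p : SharpTD.Params d F) (hp : p.Feasible) :
    ∃ nu : MvPolynomial (Fin (d + 1)) F →ₐ[F] SharpTD.TTildeCorner p,
      (∀ i : Fin (d + 1), nu (MvPolynomial.X i) = SharpTD.cornerGen p i) ∧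
      (Function.Bijective nu ↔
        ∀ n : ℕ, SharpTD.IsDirect p (SharpTD.bracketType d n)) := by
  obtain ⟨nu, hnu, hsurj⟩ := SharpTD.exists_nu hp
  exact ⟨nu, hnu, (and_iff_left hsurj).trans (SharpTD.injective_iff_isDirect hnu)⟩
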